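/- Let $X=(X_t)_{t\ge 0}$ be a spectrally negative L\'evy process, i.e. a real-valued c\`adl\`ag process with $X_0=0$ and stationary independent increments, whose law is given by $E(e^{i\theta X_t})=e^{-t\Psi(\theta)}$, $\theta\in\mathbb R$, $$\Psi(\theta)=i\mu\theta+\tfrac{\sigma^2}{2}\theta^2+\int_{\mathbb R\setminus\{0\}}\bigl(1-e^{i\theta x}+i\theta x\mathbf 1_{|x|<1}\bigr)\,\Pi(dx),$$ with $\mu,\sigma\in\mathbb R$ and a measure $\Pi$ on $\mathbb R\setminus\{0\}$ satisfying $\int(1\wedge x^2)\,\Pi(dx)<\infty$ and $\Pi(0,\infty)=0$; the case in which $X$ has monotone paths almost surely is excluded. Let $\psi$ be its Laplace exponent, $E(e^{\lambda X_t})=e^{\psi(\lambda)t}$ for $\lambda\ge 0$, and for $q\ge 0$ let $\Phi(q)=\sup\{\lambda\ge 0:\psi(\lambda)=q\}$. Let $W^{(q)}:\mathbb R\to[0,\infty)$ be the $q$-scale function, i.e. $W^{(q)}(x)=0$ for $x<0$, and on $[0,\infty)$ it is the unique right-continuous function with $$\int_0^\infty e^{-\beta x}W^{(q)}(x)\,dx=\frac{1}{\psi(\beta)-q},\qquad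 \beta>\Phi(q).$$ Write $\overline\Pi(x)=\Pi(-\infty,-x)$ for $x>0$, and suppose that $-\overline\Pi$ has a density on $(0,\infty)$ which is completely monotone: $\overline\Pi(x)=\int_x^\infty \pi(y)\,dy$ for all $x>0$, where $\pi$ is infinitely differentiable on $(0,\infty)$ and $(-1)^n\pi^{(n)}\ge 0$ there for all $n\ge 0$. Let $q>0$, or let $q=0$ and $\Phi(0)>0$. Then $W^{(q)}$ is differentiable on $(0,\infty)$ and its derivative is strictly convex on $(0,\infty)$. In particular there is a constant $a^*\in[0,\infty)$ such that $W^{(q)}$ is strictly concave on $(0,a^*)$ and strictly convex on $(a^*,\infty)$. -/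

import Mathlib

open Set Filter Topology MeasureTheory ProbabilityTheory
open scoped NNReal ENNReal

/-- A real-valued Lévy process on `(Ω, P)`: it starts from `0`, has stationary and independent
increments, and almost surely has paths that are right-continuous with left limits. -/
structure IsLevyProcess {Ω : Type*} [MeasurableSpace Ω] (X : ℝ≥0 → Ω → ℝ) (P : Measure Ω) :
    Prop where
  measurable : ∀ t, Measurable (X t)
  start : ∀ᵐ ω ∂P, X 0 ω = 0
  indep : HasIndepIncrements X P
  stationary : ∀ s t : ℝ≥0, IdentDistrib (fun ω => X (s + t) ω - X s ω) (X t) P P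
  cadlag : ∀ᵐ ω ∂P, ∀ t : ℝ≥0, ContinuousWithinAt (fun s => X s ω) (Ici t) t ∧
    ∃ l : ℝ, Tendsto (fun s => X s ω) (𝓝[<] t) (𝓝 l)

/-- `ν` is a measure carried by `ℝ ∖ {0}` that integrates `1 ∧ x²`. -/
structure IsLevyMeasure (ν : Measure ℝ) : Prop where
  zero : ν {0} = 0
  lintegral_lt_top : ∫⁻ x, ENNReal.ofReal (min 1 (x ^ 2)) ∂ν < ∞

/-- The characteristic exponent
`Ψ(θ) = i μ θ + σ² θ² / 2 + ∫ (1 - e^{iθx} + i θ x 1_{|x| < 1}) ν(dx)`. -/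
noncomputable def levyKhintchineExponent (μ σ : ℝ) (ν : Measure ℝ) (θ : ℝ) : ℂ :=
  Complex.I * μ * θ + (σ : ℂ) ^ 2 / 2 * (θ : ℂ) ^ 2 +
    ∫ x : ℝ, (1 - Complex.exp (Complex.I * θ * x) +
      (if |x| < 1 then Complex.I * θ * x else 0)) ∂ν

/-- The Lévy process `X` has Lévy–Khintchine triplet `(μ, σ, ν)`; in particular `ν` is its
Lévy measure: `E e^{iθ X_t} = e^{-t Ψ(θ)}`. -/
structure HasLevyTriplet {Ω : Type*} [MeasurableSpace Ω] (X : ℝ≥0 → Ω → ℝ) (P : Measure Ω)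
    (μ σ : ℝ) (ν : Measure ℝ) : Prop where
  isLevyMeasure : IsLevyMeasure ν
  charFun_eq : ∀ (t : ℝ≥0) (θ : ℝ), charFun (P.map (X t)) θ =
    Complex.exp (-((t : ℝ) : ℂ) * levyKhintchineExponent μ σ ν θ)

/-- A spectrally negative Lévy process with triplet `(μ, σ, ν)`: a Lévy process whose Lévy measure
does not charge `(0, ∞)`, the case of (almost surely) monotone paths being excluded. -/
structure IsSpectrallyNegativeLevy {Ω : Type*} [MeasurableSpace Ω] (X : ℝ≥0 → Ω → ℝ)
    (P : Measure Ω) (μ σ : ℝ) (ν : Measure ℝ) : Prop where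
  isLevy : IsLevyProcess X P
  triplet : HasLevyTriplet X P μ σ ν
  no_pos_jumps : ν (Ioi 0) = 0
  not_monotone : ¬ ∀ᵐ ω ∂P, Monotone (fun t => X t ω)
  not_antitone : ¬ ∀ᵐ ω ∂P, Antitone (fun t => X t ω)

/-- The Laplace exponent `ψ(l) = log E e^{l X_1}`. -/
noncomputable def laplaceExponent {Ω : Type*} [MeasurableSpace Ω] (X : ℝ≥0 → Ω → ℝ)
    (P : Measure Ω) (l : ℝ) : ℝ :=
  cgf (X 1) P l

/-- `Φ(q) = sup {l ≥ 0 : ψ(l) = q}`, for a function `ψ`. -/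
noncomputable def largestRoot (ψ : ℝ → ℝ) (q : ℝ) : ℝ :=
  sSup {l : ℝ | 0 ≤ l ∧ ψ l = q}

/-- `W` is the `q`-scale function attached to the Laplace exponent `ψ`: it takes values in `[0, ∞)`,
vanishes on `(-∞, 0)`, is right-continuous on `[0, ∞)`, and its Laplace transform at every
`β > Φ(q)` is (finite and) equal to `1 / (ψ(β) - q)`. -/
structure IsScaleFunction (ψ : ℝ → ℝ) (q : ℝ) (W : ℝ → ℝ) : Prop where
  nonneg : ∀ x, 0 ≤ W x
  eq_zero : ∀ x < 0, W x = 0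
  rightCont : ∀ x, 0 ≤ x → ContinuousWithinAt W (Ici x) x
  integrable : ∀ β, largestRoot ψ q < β →
    IntegrableOn (fun x => Real.exp (-β * x) * W x) (Ioi 0)
  laplace : ∀ β, largestRoot ψ q < β →
    ∫ x in Ioi (0 : ℝ), Real.exp (-β * x) * W x = 1 / (ψ β - q)

/-- `f` is completely monotone on `(0, ∞)`. -/
def IsCompletelyMonotone (f : ℝ → ℝ) : Prop :=
  ContDiffOn ℝ ((⊤ : ℕ∞) : WithTop ℕ∞) f (Ioi 0) ∧ ∀ (n : ℕ) (x : ℝ), 0 < x → 0 ≤ (-1) ^ n * iteratedDeriv n f x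

/-- The function `-Π̄`, where `Π̄(x) = ν(-∞, -x)` for `x > 0`, has a completely monotone density
`f` on `(0, ∞)`, i.e. `Π̄(x) = ∫_x^∞ f(y) dy` for all `x > 0`. -/
def HasCompletelyMonotoneTailDensity (ν : Measure ℝ) : Prop :=
  ∃ f : ℝ → ℝ, IsCompletelyMonotone f ∧
    ∀ x : ℝ, 0 < x → ν (Iio (-x)) = ∫⁻ y in Ioi x, ENNReal.ofReal (f y)

/-!
Bernstein's theorem writes the jump density as a Laplace transform, so that the Laplace exponent is
`ψ(b) = b (ψ(1) + (b - 1) R(b))` with `R` a Stieltjes function. Dividing out the root `Φ = Φ(q) > 0`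
gives `ψ(b) - q = (b - Φ) b S(b)` with `S` again Stieltjes. The reciprocal of `b ↦ b S(b)` is also
a Stieltjes function: when `S` is a finite mixture of simple poles this is the resolvent of
a rank-one perturbation of a diagonal matrix, and the general case follows by weak limits. Hence
`1 / (ψ(b) - q) = A / (b - Φ) - ∫ (b + s)⁻¹ m(ds)` with `A > 0` and a finite measure `m` on
`[0, ∞)`, that is, `W(x) = A e^{Φ x} - ∫ e^{-s x} m(ds)` for `x > 0`, and the third derivative of
such a function is positive.
-/

/-! ### Stieltjes functions -/

theorem exists_integral_eq_of_tendsto {E : Type*} [MeasurableSpace E] [TopologicalSpace E]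
    [T2Space E] [BorelSpace E] [CompactSpace E] (κ : ℕ → Measure E) [∀ n, IsFiniteMeasure (κ n)]
    (C : ℝ≥0) (hC : ∀ n, κ n univ ≤ C) :
    ∃ κ₀ : Measure E, IsFiniteMeasure κ₀ ∧ ∀ h : E → ℝ, Continuous h → ∀ l : ℝ,
      Tendsto (fun n => ∫ x, h x ∂κ n) atTop (𝓝 l) → ∫ x, h x ∂κ₀ = l := by
  let κ' : ℕ → FiniteMeasure E := fun n => ⟨κ n, inferInstance⟩
  have hmass : ∀ n, (κ' n).mass ≤ C := fun n => by
    rw [← ENNReal.coe_le_coe, FiniteMeasure.ennreal_mass]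
    exact hC n
  obtain ⟨κ₀, -, hlim⟩ :=
    (isCompact_setOfPred_finiteMeasure_le_of_compactSpace E C).ultrafilter_le_nhds
      ((hyperfilter ℕ).map κ') (le_principal_iff.2 (mem_map.2 (univ_mem' hmass)))
  refine ⟨κ₀, inferInstance, fun h hh l hl => ?_⟩
  have hultra := (FiniteMeasure.tendsto_iff_forall_integral_tendsto.1
    (show Tendsto κ' (hyperfilter ℕ : Filter ℕ) (𝓝 κ₀) from hlim))
    (BoundedContinuousFunction.mkOfCompact ⟨h, hh⟩)
  exact tendsto_nhds_unique hultra (hl.mono_left Nat.hyperfilter_le_atTop)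

/-- The kernel `1 / (1 + (b - 1) u)` on `[0, 1]`. With `u = 1 / (1 + s)` it is
`(1 + s) / (b + s)`, so that `[0, 1]` is a compactification of the set of poles `-s ∈ (-∞, 0]`
in which `u = 0`, i.e. `s = ∞`, gives the constant function. -/
noncomputable def cauchyKernel (b : ℝ) (u : unitInterval) : ℝ := (1 + (b - 1) * (u : ℝ))⁻¹

section cauchyKernel

variable {b : ℝ}

theorem cauchyKernel_denom_pos (hb : 0 < b) (u : unitInterval) : 0 < 1 + (b - 1) * (u : ℝ) := by
  rcases u.2.1.eq_or_lt with h | h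
  · simp [← h]
  · nlinarith [mul_pos hb h, u.2.2]

theorem cauchyKernel_pos (hb : 0 < b) (u : unitInterval) : 0 < cauchyKernel b u :=
  inv_pos.2 (cauchyKernel_denom_pos hb u)

theorem inv_max_le_cauchyKernel (hb : 0 < b) (u : unitInterval) :
    (max 1 b)⁻¹ ≤ cauchyKernel b u := by
  refine inv_anti₀ (cauchyKernel_denom_pos hb u) ?_
  nlinarith [u.2.1, u.2.2, le_max_left 1 b, le_max_right 1 b]

theorem cauchyKernel_le_max (hb : 0 < b) (u : unitInterval) :
    cauchyKernel b u ≤ (min 1 b)⁻¹ := by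
  refine inv_anti₀ (lt_min one_pos hb) ?_
  nlinarith [u.2.1, u.2.2, min_le_left 1 b, min_le_right 1 b]

theorem continuous_cauchyKernel (hb : 0 < b) : Continuous (cauchyKernel b) :=
  Continuous.inv₀ (by fun_prop) fun u => (cauchyKernel_denom_pos hb u).ne'

theorem integrable_cauchyKernel (hb : 0 < b) (κ : Measure unitInterval) [IsFiniteMeasure κ] :
    Integrable (cauchyKernel b) κ :=
  (continuous_cauchyKernel hb).integrable_of_hasCompactSupport (.of_compactSpace _)

end cauchyKernel

/-- Stieltjes functions on `(0, ∞)`, i.e. the mixtures of a constant and the functions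
`1 / (b + s)`, `s ≥ 0`. -/
def IsStieltjes (F : ℝ → ℝ) : Prop :=
  ∃ κ : Measure unitInterval, IsFiniteMeasure κ ∧ ∀ b, 0 < b → F b = ∫ u, cauchyKernel b u ∂κ

namespace IsStieltjes

variable {F G : ℝ → ℝ}

theorem congr (hF : IsStieltjes F) (h : ∀ b, 0 < b → G b = F b) : IsStieltjes G := by
  obtain ⟨κ, hκ, hF⟩ := hF
  exact ⟨κ, hκ, fun b hb => (h b hb).trans (hF b hb)⟩

theorem exists_of_tendsto {F : ℕ → ℝ → ℝ} {s : Set ℝ} (hs : s ⊆ Ioi 0) (hne : s.Nonempty)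
    (hF : ∀ n, IsStieltjes (F n)) (h : ∀ b ∈ s, Tendsto (fun n => F n b) atTop (𝓝 (G b))) :
    ∃ S, IsStieltjes S ∧ EqOn S G s := by
  choose κ hκ hF using hF
  obtain ⟨b₀, hb₀⟩ := hne
  obtain ⟨C, hC⟩ := (h b₀ hb₀).bddAbove_range
  have hmass : ∀ n, (κ n).real univ ≤ max 1 b₀ * C := fun n => by
    rw [← inv_mul_le_iff₀ (by positivity)]
    calc (max 1 b₀)⁻¹ * (κ n).real univ = ∫ _, (max 1 b₀)⁻¹ ∂κ n := by simp [mul_comm]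
      _ ≤ ∫ u, cauchyKernel b₀ u ∂κ n :=
        integral_mono (integrable_const _) (integrable_cauchyKernel (hs hb₀) _)
          (inv_max_le_cauchyKernel (hs hb₀))
      _ = F n b₀ := (hF n b₀ (hs hb₀)).symm
      _ ≤ C := hC ⟨n, rfl⟩
  obtain ⟨κ₀, hfin, hκ₀⟩ := exists_integral_eq_of_tendsto κ (max 1 b₀ * C).toNNReal fun n => by
    rw [← ofReal_measureReal]
    exact ENNReal.ofReal_le_ofReal (hmass n)
  exact ⟨fun b => ∫ u, cauchyKernel b u ∂κ₀, ⟨κ₀, hfin, fun _ _ => rfl⟩, fun b hb =>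
    hκ₀ _ (continuous_cauchyKernel (hs hb)) _ ((h b hb).congr fun n => hF n b (hs hb))⟩

theorem of_tendsto {F : ℕ → ℝ → ℝ} (hF : ∀ n, IsStieltjes (F n))
    (h : ∀ b, 0 < b → Tendsto (fun n => F n b) atTop (𝓝 (G b))) : IsStieltjes G := by
  obtain ⟨S, hS, hSG⟩ := exists_of_tendsto Subset.rfl nonempty_Ioi hF h
  exact hS.congr fun b hb => (hSG hb).symm

theorem zero : IsStieltjes fun _ => 0 := ⟨0, inferInstance, fun b _ => by simp⟩

theorem add (hF : IsStieltjes F) (hG : IsStieltjes G) : IsStieltjes fun b => F b + G b := by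
  obtain ⟨κ, hκ, hF⟩ := hF
  obtain ⟨κ', hκ', hG⟩ := hG
  exact ⟨κ + κ', inferInstance, fun b hb => by
    beta_reduce
    rw [hF b hb, hG b hb, integral_add_measure (integrable_cauchyKernel hb κ)
      (integrable_cauchyKernel hb κ')]⟩

theorem const_mul (hF : IsStieltjes F) {c : ℝ} (hc : 0 ≤ c) : IsStieltjes fun b => c * F b := by
  obtain ⟨κ, hκ, hF⟩ := hF
  exact ⟨c.toNNReal • κ, inferInstance, fun b hb => by
    beta_reduce
    rw [hF b hb, integral_smul_nnreal_measure, NNReal.smul_def, Real.coe_toNNReal c hc,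
      smul_eq_mul]⟩

theorem sum {ι : Type*} (s : Finset ι) {F : ι → ℝ → ℝ} (hF : ∀ i ∈ s, IsStieltjes (F i)) :
    IsStieltjes fun b => ∑ i ∈ s, F i b := by
  classical
  induction s using Finset.induction_on with
  | empty => simpa using zero
  | insert i s hi ih =>
    simp_rw [Finset.sum_insert hi]
    exact (hF i (by simp)).add (ih fun j hj => hF j (by simp [hj]))

end IsStieltjes

theorem isStieltjes_cauchyKernel (u : unitInterval) : IsStieltjes fun b => cauchyKernel b u :=
  ⟨Measure.dirac u, inferInstance, fun b _ => by rw [integral_dirac]⟩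

theorem isStieltjes_const {c : ℝ} (hc : 0 ≤ c) : IsStieltjes fun _ => c :=
  ((isStieltjes_cauchyKernel 0).const_mul hc).congr fun b _ => by simp [cauchyKernel]

theorem inv_one_add_mul_cauchyKernel {t : ℝ} (ht : 0 ≤ t) (b : ℝ) {u : unitInterval}
    (hu : (u : ℝ) = (1 + t)⁻¹) : (1 + t)⁻¹ * cauchyKernel b u = (t + b)⁻¹ := by
  rw [cauchyKernel, hu, ← mul_inv]
  congr 1
  field_simp
  ring

theorem isStieltjes_inv_add {t : ℝ} (ht : 0 ≤ t) : IsStieltjes fun b => (t + b)⁻¹ := by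
  have hu : (1 + t)⁻¹ ∈ Icc (0 : ℝ) 1 := ⟨by positivity, inv_le_one_of_one_le₀ (by linarith)⟩
  exact ((isStieltjes_cauchyKernel ⟨_, hu⟩).const_mul hu.1).congr fun b _ =>
    (inv_one_add_mul_cauchyKernel ht b rfl).symm

theorem isStieltjes_lintegral_inv_add {τ : Measure ℝ} (hτ : ∀ᵐ s ∂τ, 0 ≤ s) {b₀ : ℝ} (hb₀ : 0 < b₀)
    (hfin : ∫⁻ s, ENNReal.ofReal (s + b₀)⁻¹ ∂τ ≠ ∞) :
    IsStieltjes fun b => (∫⁻ s, ENNReal.ofReal (s + b)⁻¹ ∂τ).toReal := by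
  let w : ℝ → ℝ≥0∞ := fun s => ENNReal.ofReal (1 + s)⁻¹
  let U : ℝ → unitInterval := fun s => projIcc 0 1 zero_le_one (1 + s)⁻¹
  have hw : Measurable w := by fun_prop
  have hU : Measurable U := continuous_projIcc.measurable.comp (by fun_prop)
  have hkernel : ∀ b, 0 < b → ∫⁻ u, ENNReal.ofReal (cauchyKernel b u) ∂(τ.withDensity w).map U =
      ∫⁻ s, ENNReal.ofReal (s + b)⁻¹ ∂τ := fun b hb => by
    have hmeas := (continuous_cauchyKernel hb).measurable
    rw [lintegral_map hmeas.ennreal_ofReal hU, lintegral_withDensity_eq_lintegral_mul _ hw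
      (g := fun s => ENNReal.ofReal (cauchyKernel b (U s))) (hmeas.comp hU).ennreal_ofReal]
    refine lintegral_congr_ae (hτ.mono fun s hs => ?_)
    have hmem : (1 + s)⁻¹ ∈ Icc (0 : ℝ) 1 :=
      ⟨by positivity, inv_le_one_of_one_le₀ (by linarith)⟩
    rw [Pi.mul_apply, ← ENNReal.ofReal_mul hmem.1,
      inv_one_add_mul_cauchyKernel hs b (by simp only [U, projIcc_of_mem _ hmem])]
  have hfinite : IsFiniteMeasure ((τ.withDensity w).map U) := by
    refine ⟨lt_top_iff_ne_top.2 fun htop => hfin ?_⟩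
    rw [← hkernel b₀ hb₀, eq_top_iff]
    calc ∞ = ∫⁻ _, ENNReal.ofReal (max 1 b₀)⁻¹ ∂(τ.withDensity w).map U := by
          rw [lintegral_const, htop, ENNReal.mul_top (by simp)]
      _ ≤ _ := lintegral_mono fun u => ENNReal.ofReal_le_ofReal (inv_max_le_cauchyKernel hb₀ u)
  refine ⟨_, hfinite, fun b hb => ?_⟩
  beta_reduce
  rw [← hkernel b hb, integral_eq_lintegral_of_nonneg_ae
    (Eventually.of_forall fun u => (cauchyKernel_pos hb u).le)
    (continuous_cauchyKernel hb).aestronglyMeasurable]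

namespace IsStieltjes

variable {S : ℝ → ℝ}

theorem nonneg (hS : IsStieltjes S) {b : ℝ} (hb : 0 < b) : 0 ≤ S b := by
  obtain ⟨κ, -, hS⟩ := hS
  exact hS b hb ▸ integral_nonneg fun u => (cauchyKernel_pos hb u).le

theorem pos_of_ne_zero (hS : IsStieltjes S) {b₀ : ℝ} (hb₀ : 0 < b₀) (h : S b₀ ≠ 0) {b : ℝ}
    (hb : 0 < b) : 0 < S b := by
  obtain ⟨κ, hκ, hS⟩ := hS
  have hne : κ ≠ 0 := by
    rintro rfl
    exact h (by simp [hS b₀ hb₀])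
  have hsupp : Function.support (cauchyKernel b) = univ :=
    eq_univ_of_forall fun u => (cauchyKernel_pos hb u).ne'
  rw [hS b hb, integral_pos_iff_support_of_nonneg (fun u => (cauchyKernel_pos hb u).le)
    (integrable_cauchyKernel hb κ), hsupp]
  exact Measure.measure_univ_pos.2 hne

theorem continuousOn (hS : IsStieltjes S) : ContinuousOn S (Ioi 0) := by
  obtain ⟨κ, hκ, hS⟩ := hS
  refine ContinuousOn.congr (fun b₀ (hb₀ : 0 < b₀) => ContinuousAt.continuousWithinAt ?_) hS
  have hmem : Ioi (b₀ / 2) ∈ 𝓝 b₀ := Ioi_mem_nhds (half_lt_self hb₀)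
  refine continuousAt_of_dominated (bound := fun _ => (min 1 (b₀ / 2))⁻¹) ?_ ?_
    (integrable_const _) (.of_forall fun u => ?_)
  · filter_upwards [hmem] with b hb
    exact (continuous_cauchyKernel ((half_pos hb₀).trans hb)).aestronglyMeasurable
  · filter_upwards [hmem] with b (hb : b₀ / 2 < b)
    have hb0 : 0 < b := (half_pos hb₀).trans hb
    refine .of_forall fun u => ?_
    rw [Real.norm_of_nonneg (cauchyKernel_pos hb0 u).le]
    exact (cauchyKernel_le_max hb0 u).trans
      (inv_anti₀ (lt_min one_pos (half_pos hb₀)) (min_le_min_left 1 hb.le))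
  · exact ContinuousAt.inv₀ (by fun_prop) (cauchyKernel_denom_pos hb₀ u).ne'

end IsStieltjes

/-! ### The reciprocal of a Stieltjes function -/

section Reciprocal

open Matrix

variable {ι : Type*} [Fintype ι]

theorem isStieltjes_dotProduct_resolvent {A : Matrix ι ι ℝ} (hA : A.PosSemidef) {v : ι → ℝ}
    {y : ℝ → ι → ℝ} (hy : ∀ b, 0 < b → A *ᵥ y b + b • y b = v) :
    IsStieltjes fun b => v ⬝ᵥ y b := by
  classical
  let e := hA.1.eigenvectorBasis
  let t := hA.1.eigenvalues
  let c : ι → ℝ := fun j => ⇑(e j) ⬝ᵥ v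
  have hcoord : ∀ b, 0 < b → ∀ j, ⇑(e j) ⬝ᵥ y b = c j * (t j + b)⁻¹ := fun b hb j => by
    have hAe : ⇑(e j) ⬝ᵥ A *ᵥ y b = t j * (⇑(e j) ⬝ᵥ y b) := by
      rw [dotProduct_mulVec, ← mulVec_transpose, ← conjTranspose_eq_transpose_of_trivial, hA.1.eq,
        hA.1.mulVec_eigenvectorBasis, smul_dotProduct, smul_eq_mul]
    rw [eq_mul_inv_iff_mul_eq₀ (add_pos_of_nonneg_of_pos (hA.eigenvalues_nonneg j) hb).ne']
    simp only [c, ← hy b hb, dotProduct_add, dotProduct_smul, hAe, smul_eq_mul]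
    ring
  have hparseval : ∀ b, v ⬝ᵥ y b = ∑ j, c j * (⇑(e j) ⬝ᵥ y b) := fun b => by
    have h := e.sum_inner_mul_inner (WithLp.toLp 2 v) (WithLp.toLp 2 (y b))
    simp only [EuclideanSpace.inner_eq_star_dotProduct, star_trivial] at h
    rw [dotProduct_comm, ← h]
    exact Finset.sum_congr rfl fun j _ => by rw [dotProduct_comm (y b)]
  refine (IsStieltjes.sum Finset.univ fun j _ => (isStieltjes_inv_add
    (hA.eigenvalues_nonneg j)).const_mul (sq_nonneg (c j))).congr fun b hb => ?_
  rw [hparseval]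
  exact Finset.sum_congr rfl fun j _ => by rw [hcoord b hb]; ring

theorem posSemidef_diagonal_sub_vecMulVec [DecidableEq ι] {s v : ι → ℝ} {a : ℝ} (ha : 0 < a)
    (hs : ∀ i, 0 < s i) (hsum : ∑ i, v i ^ 2 / s i ≤ a) :
    (diagonal s - a⁻¹ • vecMulVec v v).PosSemidef := by
  refine .of_dotProduct_mulVec_nonneg ?_ fun x => ?_
  · refine (isHermitian_diagonal s).sub (IsHermitian.smul ?_ (.all a⁻¹))
    simp only [IsHermitian, conjTranspose_vecMulVec, star_trivial]
  have hcs : (v ⬝ᵥ x) ^ 2 ≤ a * ∑ i, s i * x i ^ 2 := by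
    calc (v ⬝ᵥ x) ^ 2 ≤ (∑ i, v i ^ 2 / s i) * ∑ i, s i * x i ^ 2 :=
          Finset.sum_sq_le_sum_mul_sum_of_sq_le_mul _
            (fun i _ => div_nonneg (sq_nonneg _) (hs i).le)
            (fun i _ => mul_nonneg (hs i).le (sq_nonneg _))
            fun i _ => by have := (hs i).ne'; field_simp; rfl
      _ ≤ a * ∑ i, s i * x i ^ 2 := mul_le_mul_of_nonneg_right hsum
          (Finset.sum_nonneg fun i _ => mul_nonneg (hs i).le (sq_nonneg _))
  have hform : star x ⬝ᵥ (diagonal s - a⁻¹ • vecMulVec v v) *ᵥ x =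
      ∑ i, s i * x i ^ 2 - a⁻¹ * (v ⬝ᵥ x) ^ 2 := by
    have hdiag : x ⬝ᵥ diagonal s *ᵥ x = ∑ i, s i * x i ^ 2 :=
      Finset.sum_congr rfl fun i _ => by rw [mulVec_diagonal]; ring
    rw [star_trivial, sub_mulVec, dotProduct_sub, hdiag, smul_mulVec, dotProduct_smul,
      vecMulVec_mulVec, dotProduct_smul, dotProduct_comm x v]
    simp [sq]
  rw [hform, sub_nonneg, inv_mul_le_iff₀ ha]
  exact hcs

theorem sum_div_add_lt {r s : ι → ℝ} {a b : ℝ} (ha : 0 < a) (hr : ∀ i, 0 ≤ r i)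
    (hs : ∀ i, 0 < s i) (hsum : ∑ i, r i / s i ≤ a) (hb : 0 < b) :
    ∑ i, r i / (s i + b) < a := by
  by_cases h0 : ∀ i, r i = 0
  · simpa [h0] using ha
  push Not at h0
  obtain ⟨i, hi⟩ := h0
  exact (Finset.sum_lt_sum
    (fun j _ => div_le_div_of_nonneg_left (hr j) (hs j) (by linarith))
    ⟨i, Finset.mem_univ i, div_lt_div_of_pos_left ((hr i).lt_of_ne' hi) (hs i)
      (by linarith)⟩).trans_le hsum

theorem isStieltjes_inv_sub_sum {r s : ι → ℝ} {a : ℝ} (ha : 0 < a) (hr : ∀ i, 0 ≤ r i)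
    (hs : ∀ i, 0 < s i) (hsum : ∑ i, r i / s i ≤ a) :
    IsStieltjes fun b => (a - ∑ i, r i / (s i + b))⁻¹ := by
  classical
  let G : ℝ → ℝ := fun b => ∑ i, r i / (s i + b)
  let v : ι → ℝ := fun i => √(r i)
  let y : ℝ → ι → ℝ := fun b => (a / (a - G b)) • fun i => √(r i) / (s i + b)
  have hGlt : ∀ b, 0 < b → a - G b ≠ 0 := fun b hb =>
    (sub_pos.2 (sum_div_add_lt ha hr hs hsum hb)).ne'
  have hvy : ∀ b, v ⬝ᵥ y b = a / (a - G b) * G b := fun b => by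
    rw [dotProduct_smul, smul_eq_mul]
    congr 1
    exact Finset.sum_congr rfl fun i _ => by
      rw [← mul_div_assoc, Real.mul_self_sqrt (hr i)]
  have hA : (diagonal s - a⁻¹ • vecMulVec v v).PosSemidef :=
    posSemidef_diagonal_sub_vecMulVec ha hs (by simpa only [v, Real.sq_sqrt (hr _)] using hsum)
  have hresolvent : ∀ b, 0 < b →
      (diagonal s - a⁻¹ • vecMulVec v v) *ᵥ y b + b • y b = v := fun b hb => by
    ext i
    have hsb : s i + b ≠ 0 := (add_pos (hs i) hb).ne'
    have hG := hGlt b hb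
    simp only [sub_mulVec, smul_mulVec, vecMulVec_mulVec, hvy, Pi.add_apply, Pi.sub_apply,
      Pi.smul_apply, mulVec_diagonal, smul_eq_mul, MulOpposite.smul_eq_mul_unop,
      MulOpposite.unop_op, y, v]
    field_simp
    ring
  refine ((isStieltjes_const (inv_nonneg.2 ha.le)).add
    ((isStieltjes_dotProduct_resolvent hA hresolvent).const_mul
      (sq_nonneg a⁻¹))).congr fun b hb => ?_
  have hG := hGlt b hb
  change (a - G b)⁻¹ = _
  rw [hvy]
  field_simp
  ring

theorem isStieltjes_inv_mul_sum {c : ι → ℝ} {u : ι → unitInterval} (hc : ∀ i, 0 ≤ c i)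
    (hu : ∀ i, u i ∈ Ioo 0 1) :
    IsStieltjes fun b => (b * ∑ i, c i * cauchyKernel b (u i))⁻¹ := by
  have hu0 : ∀ i, 0 < (u i : ℝ) := fun i => (hu i).1
  have hu1 : ∀ i, (u i : ℝ) < 1 := fun i => (hu i).2
  let s : ι → ℝ := fun i => (1 - u i) / u i
  have hs : ∀ i, 0 < s i := fun i => div_pos (sub_pos.2 (hu1 i)) (hu0 i)
  have hcu : ∀ i, 0 ≤ c i / u i := fun i => div_nonneg (hc i) (hu0 i).le
  by_cases ha : ∑ i, c i / u i = 0
  · have hc0 : ∀ i, c i = 0 := fun i => by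
      have := (Finset.sum_eq_zero_iff_of_nonneg fun i _ => hcu i).1 ha i (Finset.mem_univ i)
      exact (div_eq_zero_iff.1 this).resolve_right (hu0 i).ne'
    simpa [hc0] using IsStieltjes.zero
  refine (isStieltjes_inv_sub_sum (s := s) (r := fun i => c i / u i * s i)
    (lt_of_le_of_ne (Finset.sum_nonneg fun i _ => hcu i) (Ne.symm ha))
    (fun i => mul_nonneg (hcu i) (hs i).le) hs
    (Finset.sum_congr rfl fun i _ => mul_div_cancel_right₀ _ (hs i).ne').le).congr
    fun b hb => congrArg _ ?_
  rw [Finset.mul_sum, ← Finset.sum_sub_distrib]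
  refine Finset.sum_congr rfl fun i _ => ?_
  have hui := (hu0 i).ne'
  have hdenom := (cauchyKernel_denom_pos hb (u i)).ne'
  have hsb : s i + b = (1 + (b - 1) * u i) / u i := by
    simp only [s]; field_simp; ring
  rw [hsb, cauchyKernel]
  simp only [s]
  field_simp
  ring

end Reciprocal

theorem integral_simpleFunc_comp {α β : Type*} [MeasurableSpace α] (κ : Measure α)
    [IsFiniteMeasure κ] (g : SimpleFunc α β) (h : β → ℝ) :
    ∫ x, h (g x) ∂κ = ∑ v ∈ g.range, κ.real (g ⁻¹' {v}) * h v := by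
  have hcover : ⋃ v ∈ g.range, g ⁻¹' {v} = univ :=
    eq_univ_of_forall fun x => mem_iUnion₂.2 ⟨g x, g.mem_range_self x, rfl⟩
  have hinteg : Integrable (fun x => h (g x)) κ := (g.map h).integrable_of_isFiniteMeasure
  rw [← setIntegral_univ, ← hcover, integral_biUnion_finset g.range
    (fun v _ => g.measurableSet_fiber v) ((pairwise_disjoint_fiber g).set_pairwise _)
    fun v _ => hinteg.integrableOn]
  refine Finset.sum_congr rfl fun v _ => ?_
  rw [setIntegral_congr_fun (g := fun _ => h v) (g.measurableSet_fiber v)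
    fun x (hx : g x = v) => congrArg h hx, setIntegral_const, smul_eq_mul]

theorem exists_tendsto_sum_integral {E : Type*} [PseudoMetricSpace E] [CompactSpace E] [Nonempty E]
    [MeasurableSpace E] [BorelSpace E] (κ : Measure E) [IsFiniteMeasure κ] {s : Set E}
    (hs : Dense s) :
    ∃ (N : ℕ → Finset E) (c : ℕ → E → ℝ), (∀ n, ∀ u ∈ N n, u ∈ s) ∧ (∀ n u, 0 ≤ c n u) ∧
      ∀ h : E → ℝ, Continuous h →
        Tendsto (fun n => ∑ u ∈ N n, c n u * h u) atTop (𝓝 (∫ u, h u ∂κ)) := by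
  obtain ⟨u₀, hu₀⟩ := hs.nonempty
  let d : ℕ → SimpleFunc E E := SimpleFunc.approxOn id measurable_id s u₀ hu₀
  refine ⟨fun n => (d n).range, fun n u => κ.real (d n ⁻¹' {u}), fun n u hu => ?_,
    fun n u => measureReal_nonneg, fun h hh => ?_⟩
  · obtain ⟨v, rfl⟩ := SimpleFunc.mem_range.1 hu
    exact SimpleFunc.approxOn_mem measurable_id hu₀ n v
  simp_rw [← integral_simpleFunc_comp]
  obtain ⟨C, hC⟩ := (isCompact_range hh).isBounded.exists_norm_le
  refine tendsto_integral_of_dominated_convergence (fun _ => C)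
    (fun n => (hh.measurable.comp (d n).measurable).aestronglyMeasurable) (integrable_const _)
    (fun n => .of_forall fun u => hC _ ⟨_, rfl⟩) (.of_forall fun u => (hh.tendsto u).comp ?_)
  exact SimpleFunc.tendsto_approxOn measurable_id hu₀ (hs u)

theorem IsStieltjes.inv_mul {S : ℝ → ℝ} (hS : IsStieltjes S) (hne : S 1 ≠ 0) :
    IsStieltjes fun b => (b * S b)⁻¹ := by
  have hpos : ∀ b, 0 < b → 0 < S b := fun b hb => hS.pos_of_ne_zero one_pos hne hb
  obtain ⟨κ, hκ, hS⟩ := hS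
  have hdense : Dense (Ioo (0 : unitInterval) 1) := fun u => by
    rw [closure_Ioo zero_ne_one]
    exact ⟨u.2.1, u.2.2⟩
  obtain ⟨N, c, hN, hc, hlim⟩ := exists_tendsto_sum_integral κ hdense
  refine .of_tendsto (F := fun n b => (b * ∑ u ∈ N n, c n u * cauchyKernel b u)⁻¹)
    (fun n => ?_) fun b hb => ?_
  · refine (isStieltjes_inv_mul_sum (ι := N n) (fun i => hc n i)
      (fun i => hN n i i.2)).congr fun b _ => ?_
    rw [← Finset.sum_coe_sort (N n)]
  · refine ((hS b hb ▸ hlim _ (continuous_cauchyKernel hb)).const_mul b).inv₀ ?_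
    exact (mul_pos hb (hpos b hb)).ne'

/-! ### Bernstein's theorem -/

/-- The sign-normalised derivative `(-1)ⁿ f⁽ⁿ⁾`, which is non-negative when `f` is completely
monotone. -/
noncomputable def alternatingDeriv (f : ℝ → ℝ) (n : ℕ) (x : ℝ) : ℝ :=
  (-1) ^ n * iteratedDeriv n f x

@[simp]
theorem alternatingDeriv_zero (f : ℝ → ℝ) : alternatingDeriv f 0 = f := by
  ext x
  simp [alternatingDeriv]

theorem measurable_alternatingDeriv_succ (f : ℝ → ℝ) (n : ℕ) :
    Measurable (alternatingDeriv f (n + 1)) := by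
  unfold alternatingDeriv
  rw [iteratedDeriv_succ]
  exact (measurable_deriv _).const_mul _

namespace IsCompletelyMonotone

variable {f : ℝ → ℝ}

theorem alternatingDeriv_nonneg (hf : IsCompletelyMonotone f) (n : ℕ) {y : ℝ} (hy : 0 < y) :
    0 ≤ alternatingDeriv f n y :=
  hf.2 n y hy

theorem nonneg (hf : IsCompletelyMonotone f) {y : ℝ} (hy : 0 < y) : 0 ≤ f y := by
  simpa using hf.alternatingDeriv_nonneg 0 hy

theorem continuousOn (hf : IsCompletelyMonotone f) : ContinuousOn f (Ioi 0) := hf.1.continuousOn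

theorem hasDerivAt_alternatingDeriv (hf : IsCompletelyMonotone f) (n : ℕ) {y : ℝ} (hy : 0 < y) :
    HasDerivAt (alternatingDeriv f n) (-alternatingDeriv f (n + 1) y) y := by
  have hdiff : DifferentiableOn ℝ (iteratedDeriv n f) (Ioi 0) :=
    (hf.1.differentiableOn_iteratedDerivWithin (by exact_mod_cast WithTop.coe_lt_top _)
      (uniqueDiffOn_Ioi 0)).congr fun x hx => (iteratedDerivWithin_of_isOpen isOpen_Ioi hx).symm
  have hderiv : HasDerivAt (iteratedDeriv n f) (iteratedDeriv (n + 1) f y) y := by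
    rw [iteratedDeriv_succ]
    exact (hdiff.differentiableAt (Ioi_mem_nhds hy)).hasDerivAt
  have hsucc : -alternatingDeriv f (n + 1) y = (-1) ^ n * iteratedDeriv (n + 1) f y := by
    simp only [alternatingDeriv, pow_succ]
    ring
  exact hsucc ▸ hderiv.const_mul ((-1 : ℝ) ^ n)

theorem antitoneOn_alternatingDeriv (hf : IsCompletelyMonotone f) (n : ℕ) :
    AntitoneOn (alternatingDeriv f n) (Ioi 0) := by
  refine antitoneOn_of_hasDerivWithinAt_nonpos (convex_Ioi 0)
    (fun y hy => (hf.hasDerivAt_alternatingDeriv n hy).continuousAt.continuousWithinAt)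
    (f' := fun y => -alternatingDeriv f (n + 1) y) (fun y hy => ?_) fun y hy => ?_ <;>
    rw [interior_Ioi] at hy
  · exact (hf.hasDerivAt_alternatingDeriv n hy).hasDerivWithinAt
  · exact neg_nonpos.2 (hf.alternatingDeriv_nonneg _ hy)

theorem antitoneOn (hf : IsCompletelyMonotone f) : AntitoneOn f (Ioi 0) := by
  simpa using hf.antitoneOn_alternatingDeriv 0

theorem tendsto_alternatingDeriv (hf : IsCompletelyMonotone f) (h0 : Tendsto f atTop (𝓝 0))
    (n : ℕ) : Tendsto (alternatingDeriv f n) atTop (𝓝 0) := by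
  induction n with
  | zero => simpa using h0
  | succ n ih =>
    have hshift : Tendsto (fun y : ℝ => alternatingDeriv f n (y - 1)) atTop (𝓝 0) :=
      ih.comp (tendsto_atTop_add_const_right _ (-1) tendsto_id)
    refine tendsto_of_tendsto_of_tendsto_of_le_of_le' tendsto_const_nhds hshift ?_ ?_
    · filter_upwards [eventually_gt_atTop 0] with y hy using hf.alternatingDeriv_nonneg _ hy
    · filter_upwards [eventually_gt_atTop 1] with y hy
      obtain ⟨c, hc, hslope⟩ := exists_hasDerivAt_eq_slope (alternatingDeriv f n)
        (fun z => -alternatingDeriv f (n + 1) z) (show y - 1 < y by linarith)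
        (fun z hz => (hf.hasDerivAt_alternatingDeriv n
          (by linarith [hz.1])).continuousAt.continuousWithinAt)
        (fun z hz => hf.hasDerivAt_alternatingDeriv n (by linarith [hz.1]))
      have hcy : alternatingDeriv f (n + 1) y ≤ alternatingDeriv f (n + 1) c :=
        hf.antitoneOn_alternatingDeriv (n + 1) (mem_Ioi.2 (by linarith [hc.1]))
          (mem_Ioi.2 (by linarith)) hc.2.le
      have hy0 := hf.alternatingDeriv_nonneg n (show 0 < y by linarith)
      rw [sub_sub_cancel, div_one] at hslope
      linarith

theorem ofReal_alternatingDeriv_eq_lintegral (hf : IsCompletelyMonotone f)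
    (h0 : Tendsto f atTop (𝓝 0)) (n : ℕ) {x : ℝ} (hx : 0 < x) :
    ENNReal.ofReal (alternatingDeriv f n x) =
      ∫⁻ y in Ioi x, ENNReal.ofReal (alternatingDeriv f (n + 1) y) := by
  have hderiv : ∀ y ∈ Ici x, HasDerivAt (alternatingDeriv f n) (-alternatingDeriv f (n + 1) y) y :=
    fun y hy => hf.hasDerivAt_alternatingDeriv n (hx.trans_le hy)
  have hneg : ∀ y ∈ Ioi x, -alternatingDeriv f (n + 1) y ≤ 0 :=
    fun y hy => neg_nonpos.2 (hf.alternatingDeriv_nonneg _ (hx.trans hy))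
  have hlim := hf.tendsto_alternatingDeriv h0 n
  have hinteg := integrableOn_Ioi_deriv_of_nonpos' hderiv hneg hlim
  have hval := integral_Ioi_of_hasDerivAt_of_nonpos' hderiv hneg hlim
  rw [integral_neg, zero_sub, neg_inj] at hval
  rw [← hval, ofReal_integral_eq_lintegral_ofReal (integrable_neg_iff.1 hinteg)]
  filter_upwards [ae_restrict_mem measurableSet_Ioi] with y hy
  exact hf.alternatingDeriv_nonneg _ (hx.trans hy)

end IsCompletelyMonotone

theorem lintegral_Ioi_mul_lintegral_Ioi (μ : Measure ℝ) [SFinite μ] {F G : ℝ → ℝ≥0∞}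
    (hF : Measurable F) (hG : Measurable G) (x : ℝ) :
    ∫⁻ y in Ioi x, F y * ∫⁻ z in Ioi y, G z ∂μ ∂μ =
      ∫⁻ z in Ioi x, G z * ∫⁻ y in Ioo x z, F y ∂μ ∂μ := by
  let K : ℝ → ℝ → ℝ≥0∞ := fun y z => if x < y ∧ y < z then F y * G z else 0
  have hK : Measurable (Function.uncurry K) :=
    .ite ((measurableSet_lt measurable_const measurable_fst).inter
      (measurableSet_lt measurable_fst measurable_snd)) (by fun_prop) measurable_const
  have hleft : ∀ y, ∫⁻ z, K y z ∂μ = (Ioi x).indicator (fun y => F y * ∫⁻ z in Ioi y, G z ∂μ) y :=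
    fun y => by
      by_cases hy : x < y
      · rw [indicator_of_mem (mem_Ioi.2 hy), ← lintegral_const_mul _ hG,
          ← lintegral_indicator measurableSet_Ioi]
        simp only [K, indicator_apply, mem_Ioi, hy, true_and]
      · simp [K, hy]
  have hright : ∀ z, ∫⁻ y, K y z ∂μ =
      (Ioi x).indicator (fun z => G z * ∫⁻ y in Ioo x z, F y ∂μ) z := fun z => by
    by_cases hz : x < z
    · rw [indicator_of_mem (mem_Ioi.2 hz), ← lintegral_const_mul _ hF,
        ← lintegral_indicator measurableSet_Ioo]
      simp only [K, indicator_apply, mem_Ioo, mul_comm]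
    · have hempty : ∀ y, ¬(x < y ∧ y < z) := fun y hy => hz (hy.1.trans hy.2)
      simp [K, hz, hempty]
  rw [← lintegral_indicator measurableSet_Ioi, ← lintegral_indicator measurableSet_Ioi]
  simp_rw [← hleft, ← hright]
  exact lintegral_lintegral_swap hK.aemeasurable

theorem lintegral_Ioo_pow_div_factorial {x z : ℝ} (hxz : x < z) (n : ℕ) :
    ∫⁻ y in Ioo x z, ENNReal.ofReal ((y - x) ^ n / n.factorial) =
      ENNReal.ofReal ((z - x) ^ (n + 1) / (n + 1).factorial) := by
  have hinteg : IntegrableOn (fun y : ℝ => (y - x) ^ n / n.factorial) (Ioo x z) :=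
    ((by fun_prop : Continuous fun y : ℝ => (y - x) ^ n / n.factorial).integrableOn_Icc
      (a := x) (b := z)).mono_set Ioo_subset_Icc_self
  rw [← ofReal_integral_eq_lintegral_ofReal hinteg]
  · rw [← integral_Ioc_eq_integral_Ioo, ← intervalIntegral.integral_of_le hxz.le,
      intervalIntegral.integral_div, intervalIntegral.integral_comp_sub_right (fun y => y ^ n) x,
      integral_pow, sub_self, Nat.factorial_succ]
    push_cast
    congr 1
    field_simp
    simp
  · filter_upwards [ae_restrict_mem measurableSet_Ioo] with y hy
    exact div_nonneg (pow_nonneg (sub_nonneg.2 hy.1.le) n) (Nat.cast_nonneg _)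

/-- The remainder measure on `(ε, ∞)` in Taylor's formula for a completely monotone `f` with base
point at infinity: its density is `(-1)ⁿ⁺¹ f⁽ⁿ⁺¹⁾(y) (y - ε)ⁿ / n!`. -/
noncomputable def taylorMeasure (f : ℝ → ℝ) (n : ℕ) (ε : ℝ) : Measure ℝ :=
  (volume.restrict (Ioi ε)).withDensity fun y =>
    ENNReal.ofReal (alternatingDeriv f (n + 1) y) * ENNReal.ofReal ((y - ε) ^ n / n.factorial)

theorem ae_lt_taylorMeasure (f : ℝ → ℝ) (n : ℕ) (ε : ℝ) : ∀ᵐ y ∂taylorMeasure f n ε, ε < y :=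
  (withDensity_absolutelyContinuous _ _).ae_le (ae_restrict_mem measurableSet_Ioi)

theorem abs_exp_sub_max_pow_le {t : ℝ} (ht : 0 ≤ t) (n : ℕ) :
    |Real.exp (-t) ^ (n + 2) - max 0 (1 - t) ^ (n + 2)| ≤ 2 * (n + 2) / (n + 1) ^ 2 := by
  have hle : max 0 (1 - t) ≤ Real.exp (-t) :=
    max_le (Real.exp_pos _).le (by linarith [Real.add_one_le_exp (-t)])
  have hdiff : Real.exp (-t) - max 0 (1 - t) ≤ t ^ 2 := by
    rcases le_or_gt t 1 with h | h
    · have hquad := (abs_le.1 (Real.abs_exp_sub_one_sub_id_le (x := -t)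
        (by rwa [abs_neg, abs_of_nonneg ht]))).2
      nlinarith [le_max_right 0 (1 - t)]
    · nlinarith [Real.exp_le_one_iff.2 (neg_nonpos.2 ht), le_max_left 0 (1 - t)]
  have hdecay : ((n + 1) * t) ^ 2 * Real.exp (-t) ^ (n + 1) ≤ 2 := by
    have hquad := Real.quadratic_le_exp_of_nonneg (x := (n + 1) * t) (by positivity)
    have hexp : Real.exp (-t) ^ (n + 1) = (Real.exp ((n + 1) * t))⁻¹ := by
      rw [← Real.exp_nat_mul, ← Real.exp_neg]
      push_cast
      ring_nf
    rw [hexp, ← div_eq_mul_inv, div_le_iff₀ (Real.exp_pos _)]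
    nlinarith [show 0 ≤ (n + 1) * t by positivity]
  have hpow := abs_pow_sub_pow_le (Real.exp (-t)) (max 0 (1 - t)) (n + 2)
  rw [abs_of_nonneg (sub_nonneg.2 hle), abs_of_pos (Real.exp_pos _),
    abs_of_nonneg (le_max_left 0 (1 - t)), max_eq_left hle] at hpow
  refine hpow.trans ((le_div_iff₀ (by positivity)).2 ?_)
  rw [show n + 2 - 1 = n + 1 from rfl]
  push_cast
  calc (Real.exp (-t) - max 0 (1 - t)) * (n + 2) * Real.exp (-t) ^ (n + 1) * (n + 1) ^ 2
      ≤ t ^ 2 * (n + 2) * Real.exp (-t) ^ (n + 1) * (n + 1) ^ 2 := by gcongr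
    _ = (n + 2) * (((n + 1) * t) ^ 2 * Real.exp (-t) ^ (n + 1)) := by ring
    _ ≤ (n + 2) * 2 := by gcongr
    _ = 2 * (n + 2) := by ring

theorem tendsto_two_mul_add_two_div_sq :
    Tendsto (fun n : ℕ => 2 * ((n : ℝ) + 2) / (n + 1) ^ 2) atTop (𝓝 0) := by
  have hlim : Tendsto (fun n : ℕ => 4 * (1 / ((n : ℝ) + 1))) atTop (𝓝 0) := by
    simpa using tendsto_one_div_add_atTop_nhds_zero_nat.const_mul (4 : ℝ)
  refine squeeze_zero (fun n => by positivity) (fun n => ?_) hlim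
  rw [div_le_iff₀ (by positivity)]
  field_simp
  nlinarith [n.cast_nonneg (α := ℝ)]

namespace IsCompletelyMonotone

variable {f : ℝ → ℝ}

theorem ofReal_eq_lintegral_mul_pow (hf : IsCompletelyMonotone f) (h0 : Tendsto f atTop (𝓝 0))
    (n : ℕ) {x : ℝ} (hx : 0 < x) :
    ENNReal.ofReal (f x) = ∫⁻ y in Ioi x,
      ENNReal.ofReal (alternatingDeriv f (n + 1) y) *
        ENNReal.ofReal ((y - x) ^ n / n.factorial) := by
  induction n with
  | zero => simpa using hf.ofReal_alternatingDeriv_eq_lintegral h0 0 hx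
  | succ n ih =>
    calc ENNReal.ofReal (f x)
      _ = ∫⁻ y in Ioi x, ENNReal.ofReal (alternatingDeriv f (n + 1) y) *
          ENNReal.ofReal ((y - x) ^ n / n.factorial) := ih
      _ = ∫⁻ y in Ioi x, ENNReal.ofReal ((y - x) ^ n / n.factorial) *
          ∫⁻ z in Ioi y, ENNReal.ofReal (alternatingDeriv f (n + 2) z) := by
        refine setLIntegral_congr_fun measurableSet_Ioi fun y hy => ?_
        rw [← hf.ofReal_alternatingDeriv_eq_lintegral h0 (n + 1) (hx.trans hy), mul_comm]
      _ = _ := by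
        rw [lintegral_Ioi_mul_lintegral_Ioi _ (by fun_prop)
          (measurable_alternatingDeriv_succ f _).ennreal_ofReal]
        refine setLIntegral_congr_fun measurableSet_Ioi fun z hz => ?_
        rw [lintegral_Ioo_pow_div_factorial hz]

theorem taylorMeasure_univ (hf : IsCompletelyMonotone f) (h0 : Tendsto f atTop (𝓝 0)) (n : ℕ)
    {ε : ℝ} (hε : 0 < ε) : taylorMeasure f n ε univ = ENNReal.ofReal (f ε) := by
  rw [taylorMeasure, withDensity_apply _ MeasurableSet.univ, Measure.restrict_univ,
    hf.ofReal_eq_lintegral_mul_pow h0 n hε]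

theorem eq_integral_taylorMeasure (hf : IsCompletelyMonotone f) (h0 : Tendsto f atTop (𝓝 0))
    {n : ℕ} (hn : n ≠ 0) {ε x : ℝ} (hε : 0 < ε) (hx : 0 < x) :
    f (ε + x) = ∫ y, max 0 (1 - x / (y - ε)) ^ n ∂taylorMeasure f n ε := by
  have hdensity : Measurable fun y => ENNReal.ofReal (alternatingDeriv f (n + 1) y) *
      ENNReal.ofReal ((y - ε) ^ n / n.factorial) :=
    (measurable_alternatingDeriv_succ f n).ennreal_ofReal.mul (by fun_prop)
  rw [integral_eq_lintegral_of_nonneg_ae (.of_forall fun y => pow_nonneg (le_max_left _ _) _)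
    (Measurable.aestronglyMeasurable (by fun_prop)), taylorMeasure,
    lintegral_withDensity_eq_lintegral_mul _ hdensity (by fun_prop),
    ← ENNReal.toReal_ofReal (hf.nonneg (add_pos hε hx)),
    hf.ofReal_eq_lintegral_mul_pow h0 n (add_pos hε hx), ← lintegral_indicator measurableSet_Ioi,
    ← lintegral_indicator measurableSet_Ioi]
  congr 1
  refine lintegral_congr fun y => ?_
  simp only [indicator_apply, mem_Ioi, Pi.mul_apply]
  rcases le_or_gt y ε with hyε | hyε
  · rw [if_neg (by linarith), if_neg hyε.not_gt]
  have hpos : 0 < y - ε := sub_pos.2 hyε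
  rw [if_pos hyε]
  split_ifs with hyx
  · have hfrac : 0 ≤ 1 - x / (y - ε) := by
      rw [sub_nonneg, div_le_one hpos]
      linarith
    rw [max_eq_right hfrac, mul_assoc,
      ← ENNReal.ofReal_mul (show 0 ≤ (y - ε) ^ n / n.factorial by positivity), div_mul_eq_mul_div,
      ← mul_pow, mul_sub, mul_div_cancel₀ _ hpos.ne', mul_one, sub_sub]
  · have hfrac : 1 - x / (y - ε) ≤ 0 := by
      rw [sub_nonpos, one_le_div hpos]
      linarith
    simp [max_eq_left hfrac, hn]

theorem tendsto_integral_exp_taylorMeasure (hf : IsCompletelyMonotone f)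
    (h0 : Tendsto f atTop (𝓝 0)) {ε x : ℝ} (hε : 0 < ε) (hx : 0 < x) :
    Tendsto (fun n : ℕ => ∫ y, Real.exp (-(x / (y - ε))) ^ (n + 2) ∂taylorMeasure f (n + 2) ε)
      atTop (𝓝 (f (ε + x))) := by
  have hbound : ∀ n : ℕ,
      dist (∫ y, Real.exp (-(x / (y - ε))) ^ (n + 2) ∂taylorMeasure f (n + 2) ε) (f (ε + x)) ≤
        2 * (n + 2) / (n + 1) ^ 2 * f ε := fun n => by
    have hmass := hf.taylorMeasure_univ h0 (n + 2) hε
    have : IsFiniteMeasure (taylorMeasure f (n + 2) ε) := ⟨hmass ▸ ENNReal.ofReal_lt_top⟩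
    have hinteg : ∀ φ : ℝ → ℝ, Measurable φ → (∀ t, 0 ≤ t → φ t ∈ Icc 0 1) →
        Integrable (fun y => φ (x / (y - ε)) ^ (n + 2)) (taylorMeasure f (n + 2) ε) := by
      intro φ hφ h01
      refine .of_bound (C := 1) (Measurable.aestronglyMeasurable (by fun_prop)) ?_
      filter_upwards [ae_lt_taylorMeasure f (n + 2) ε] with y hy
      have hφ01 := h01 (x / (y - ε)) (div_nonneg hx.le (sub_nonneg.2 hy.le))
      rw [Real.norm_of_nonneg (pow_nonneg hφ01.1 _)]
      exact pow_le_one₀ hφ01.1 hφ01.2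
    rw [hf.eq_integral_taylorMeasure h0 (n + 1).succ_ne_zero hε hx, dist_eq_norm,
      ← integral_sub
        (hinteg (fun t => Real.exp (-t)) (by fun_prop)
          fun t ht => ⟨(Real.exp_pos _).le, Real.exp_le_one_iff.2 (neg_nonpos.2 ht)⟩)
        (hinteg (fun t => max 0 (1 - t)) (by fun_prop)
          fun t ht => ⟨le_max_left _ _, max_le zero_le_one (by linarith)⟩)]
    refine (norm_integral_le_of_norm_le_const (C := 2 * (n + 2) / (n + 1) ^ 2) ?_).trans_eq ?_
    · filter_upwards [ae_lt_taylorMeasure f (n + 2) ε] with y hy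
      exact abs_exp_sub_max_pow_le (div_nonneg hx.le (sub_nonneg.2 hy.le)) n
    · rw [Measure.real, hmass, ENNReal.toReal_ofReal (hf.nonneg hε)]
  rw [tendsto_iff_dist_tendsto_zero]
  exact squeeze_zero (fun n => dist_nonneg) hbound
    (by simpa using tendsto_two_mul_add_two_div_sq.mul_const (f ε))

/-- Substituting `v = exp (-n / (y - ε))` turns the Taylor kernels `(1 - x / (y - ε))₊ⁿ` into
approximations of `v ^ x`. -/
theorem exists_eq_integral_rpow (hf : IsCompletelyMonotone f) (h0 : Tendsto f atTop (𝓝 0)) {ε : ℝ}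
    (hε : 0 < ε) :
    ∃ τ : Measure unitInterval, IsFiniteMeasure τ ∧
      ∀ x, 0 < x → f (ε + x) = ∫ v, (v : ℝ) ^ x ∂τ := by
  let V : ℕ → ℝ → unitInterval := fun n y =>
    projIcc 0 1 zero_le_one (Real.exp (-(y - ε)⁻¹) ^ (n + 2))
  have hV : ∀ n, Measurable (V n) := fun n => continuous_projIcc.measurable.comp (by fun_prop)
  have hmass : ∀ n, (taylorMeasure f (n + 2) ε).map (V n) univ = ENNReal.ofReal (f ε) := fun n => by
    rw [Measure.map_apply (hV n) MeasurableSet.univ, preimage_univ, hf.taylorMeasure_univ h0 _ hε]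
  have : ∀ n, IsFiniteMeasure ((taylorMeasure f (n + 2) ε).map (V n)) := fun n =>
    ⟨hmass n ▸ ENNReal.ofReal_lt_top⟩
  obtain ⟨τ, hτ, hlim⟩ := exists_integral_eq_of_tendsto
    (fun n => (taylorMeasure f (n + 2) ε).map (V n)) (f ε).toNNReal fun n => (hmass n).le
  refine ⟨τ, hτ, fun x hx => ?_⟩
  have hcont : Continuous fun v : unitInterval => (v : ℝ) ^ x :=
    (Real.continuous_rpow_const hx.le).comp continuous_subtype_val
  refine (hlim _ hcont _ ?_).symm
  refine (hf.tendsto_integral_exp_taylorMeasure h0 hε hx).congr fun n => ?_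
  rw [integral_map (hV n).aemeasurable hcont.aestronglyMeasurable]
  refine integral_congr_ae ?_
  filter_upwards [ae_lt_taylorMeasure f (n + 2) ε] with y hy
  have hinv : 0 ≤ (y - ε)⁻¹ := inv_nonneg.2 (sub_nonneg.2 hy.le)
  have hmem : Real.exp (-(y - ε)⁻¹) ^ (n + 2) ∈ Icc (0 : ℝ) 1 :=
    ⟨by positivity, pow_le_one₀ (Real.exp_pos _).le (Real.exp_le_one_iff.2 (neg_nonpos.2 hinv))⟩
  simp only [V, projIcc_of_mem zero_le_one hmem]
  rw [← Real.exp_nat_mul, ← Real.exp_nat_mul, ← Real.exp_mul]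
  ring_nf

end IsCompletelyMonotone

namespace IsCompletelyMonotone

variable {f : ℝ → ℝ}

theorem exists_eq_integral_exp (hf : IsCompletelyMonotone f) (h0 : Tendsto f atTop (𝓝 0)) {ε : ℝ}
    (hε : 0 < ε) :
    ∃ τ : Measure ℝ, IsFiniteMeasure τ ∧ (∀ᵐ s ∂τ, 0 < s) ∧
      ∀ x, 0 < x → f (ε + x) = ∫ s, Real.exp (-(s * x)) ∂τ := by
  obtain ⟨τ, hτ, hf_eq⟩ := hf.exists_eq_integral_rpow h0 hε
  have hcont : ∀ {x : ℝ}, 0 < x → Continuous fun v : unitInterval => (v : ℝ) ^ x := fun hx =>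
    (Real.continuous_rpow_const hx.le).comp continuous_subtype_val
  have hsingleton : τ {1} = 0 := by
    refine (measureReal_eq_zero_iff).1 (le_antisymm ?_ measureReal_nonneg)
    refine ge_of_tendsto (h0.comp (tendsto_atTop_add_const_left _ ε tendsto_id)) ?_
    filter_upwards [eventually_gt_atTop 0] with x hx
    calc τ.real {1} = ∫ v in {1}, (v : ℝ) ^ x ∂τ := by simp [Measure.real]
      _ ≤ ∫ v, (v : ℝ) ^ x ∂τ := setIntegral_le_integral
          ((hcont hx).integrable_of_hasCompactSupport (.of_compactSpace _))
          (Eventually.of_forall fun v => Real.rpow_nonneg v.2.1 x)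
      _ = f (ε + x) := (hf_eq x hx).symm
  have hlog : Measurable fun v : unitInterval => -Real.log v := by fun_prop
  refine ⟨(τ.restrict {0}ᶜ).map fun v : unitInterval => -Real.log v, inferInstance, ?_,
    fun x hx => ?_⟩
  · rw [ae_map_iff hlog.aemeasurable measurableSet_Ioi,
      ae_restrict_iff' (measurableSet_singleton _).compl]
    filter_upwards [compl_mem_ae_iff.2 hsingleton] with v hv1 hv0
    exact neg_pos.2 (Real.log_neg (v.2.1.lt_of_ne fun h => hv0 (Subtype.ext h.symm))
      (v.2.2.lt_of_ne fun h => hv1 (Subtype.ext h)))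
  · rw [hf_eq x hx, integral_map hlog.aemeasurable (by fun_prop),
      ← setIntegral_eq_integral_of_forall_compl_eq_zero (s := {0}ᶜ) fun v hv => by
        simp [show v = 0 from not_not.1 hv, hx.ne']]
    refine setIntegral_congr_fun (measurableSet_singleton _).compl fun v hv => ?_
    have hv0 : 0 < (v : ℝ) := v.2.1.lt_of_ne fun h => hv (Subtype.ext h.symm)
    simp only [Real.rpow_def_of_pos hv0, neg_mul, neg_neg]

theorem tendsto_zero (hf : IsCompletelyMonotone f)
    (hfin : ∫⁻ y in Ioi 1, ENNReal.ofReal (f y) ≠ ∞) : Tendsto f atTop (𝓝 0) := by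
  have hle : ∀ y, 1 < y → f y ≤ (∫⁻ y in Ioi 1, ENNReal.ofReal (f y)).toReal / (y - 1) := by
    intro y hy
    rw [le_div_iff₀ (sub_pos.2 hy), ← ENNReal.ofReal_le_iff_le_toReal hfin,
      ENNReal.ofReal_mul (hf.nonneg (by linarith))]
    calc ENNReal.ofReal (f y) * ENNReal.ofReal (y - 1)
        = ∫⁻ _ in Ioc 1 y, ENNReal.ofReal (f y) := by rw [setLIntegral_const, Real.volume_Ioc]
      _ ≤ ∫⁻ x in Ioc 1 y, ENNReal.ofReal (f x) :=
          setLIntegral_mono' measurableSet_Ioc fun x hx => ENNReal.ofReal_le_ofReal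
            (hf.antitoneOn (one_pos.trans hx.1) (one_pos.trans hy) hx.2)
      _ ≤ ∫⁻ x in Ioi 1, ENNReal.ofReal (f x) := lintegral_mono_set Ioc_subset_Ioi_self
  refine squeeze_zero' ((eventually_gt_atTop 0).mono fun y hy => hf.nonneg hy)
    ((eventually_gt_atTop 1).mono hle) (tendsto_const_nhds.div_atTop ?_)
  exact tendsto_atTop_add_const_right _ (-1) tendsto_id

end IsCompletelyMonotone

/-- The divided difference between `1` and `b` of `b ↦ (e^{-bx} - 1) / b`, the form in which the
jumps of size `x` enter the factorisation of a Laplace exponent. -/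
noncomputable def laplaceKernel (b x : ℝ) : ℝ :=
  ((1 - Real.exp (-x)) - (1 - Real.exp (-(b * x))) / b) / (b - 1)

theorem laplaceKernel_nonneg {b : ℝ} (hb : 0 < b) (x : ℝ) : 0 ≤ laplaceKernel b x := by
  have hexp : -1 ≤ Real.exp (-x) - 1 := by linarith [Real.exp_pos (-x)]
  have hrpow : (1 + (Real.exp (-x) - 1)) ^ b = Real.exp (-(b * x)) := by
    rw [add_sub_cancel, ← Real.exp_mul]
    ring_nf
  have hnum : (1 - Real.exp (-x)) - (1 - Real.exp (-(b * x))) / b =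
      (b * (1 - Real.exp (-x)) - (1 - Real.exp (-(b * x)))) / b := by
    field_simp
  rw [laplaceKernel, hnum]
  rcases le_total 1 b with h1b | hb1
  · have hbernoulli := one_add_mul_self_le_rpow_one_add hexp h1b
    exact div_nonneg (div_nonneg (by linarith) hb.le) (by linarith)
  · have hbernoulli := rpow_one_add_le_one_add_mul_self hexp hb.le hb1
    exact div_nonneg_of_nonpos (div_nonpos_of_nonpos_of_nonneg (by linarith) hb.le) (by linarith)

theorem measurable_laplaceKernel (b : ℝ) : Measurable (laplaceKernel b) := by
  unfold laplaceKernel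
  fun_prop

theorem integrableOn_exp_neg_mul_Ioi {c : ℝ} (hc : 0 < c) :
    IntegrableOn (fun x => Real.exp (-(c * x))) (Ioi 0) := by
  simpa only [neg_mul] using integrableOn_exp_mul_Ioi (neg_neg_iff_pos.2 hc) 0

theorem integral_exp_neg_mul_Ioi {c : ℝ} (hc : 0 < c) :
    ∫ x in Ioi 0, Real.exp (-(c * x)) = c⁻¹ := by
  simpa [neg_mul] using integral_exp_mul_Ioi (neg_neg_iff_pos.2 hc) 0

theorem laplaceKernel_mul_exp (b s x : ℝ) :
    laplaceKernel b x * Real.exp (-(s * x)) =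
      ((Real.exp (-(s * x)) - Real.exp (-((s + 1) * x))) -
        (Real.exp (-(s * x)) - Real.exp (-((s + b) * x))) / b) / (b - 1) := by
  rw [laplaceKernel, div_mul_eq_mul_div, sub_mul, div_mul_eq_mul_div, sub_mul, sub_mul,
    ← Real.exp_add, ← Real.exp_add]
  ring_nf

theorem lintegral_laplaceKernel_mul_exp {s b : ℝ} (hs : 0 < s) (hb : 0 < b) (hb1 : b ≠ 1) :
    ∫⁻ x in Ioi 0, ENNReal.ofReal (laplaceKernel b x * Real.exp (-(s * x))) =
      ENNReal.ofReal ((s * (s + 1))⁻¹ * (s + b)⁻¹) := by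
  have hs1 : 0 < s + 1 := by positivity
  have hsb : 0 < s + b := by positivity
  have hinteg₁ := (integrableOn_exp_neg_mul_Ioi hs).sub (integrableOn_exp_neg_mul_Ioi hs1)
  have hinteg₂ :=
    ((integrableOn_exp_neg_mul_Ioi hs).sub (integrableOn_exp_neg_mul_Ioi hsb)).div_const b
  rw [← ofReal_integral_eq_lintegral_ofReal]
  · simp_rw [laplaceKernel_mul_exp]
    rw [integral_div, integral_sub (by exact hinteg₁) (by exact hinteg₂), integral_div,
      integral_sub (integrableOn_exp_neg_mul_Ioi hs) (integrableOn_exp_neg_mul_Ioi hs1),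
      integral_sub (integrableOn_exp_neg_mul_Ioi hs) (integrableOn_exp_neg_mul_Ioi hsb),
      integral_exp_neg_mul_Ioi hs, integral_exp_neg_mul_Ioi hs1, integral_exp_neg_mul_Ioi hsb]
    have hb1' : b - 1 ≠ 0 := sub_ne_zero.2 hb1
    congr 1
    field_simp
    ring
  · simp_rw [laplaceKernel_mul_exp]
    exact (hinteg₁.sub hinteg₂).div_const (b - 1)
  · exact Eventually.of_forall fun x =>
      mul_nonneg (laplaceKernel_nonneg hb x) (Real.exp_pos _).le

theorem lintegral_laplaceKernel_mul_integral_exp {τ : Measure ℝ} [IsFiniteMeasure τ]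
    (hτ : ∀ᵐ s ∂τ, 0 < s) {b : ℝ} (hb : 0 < b) (hb1 : b ≠ 1) :
    ∫⁻ x in Ioi 0, ENNReal.ofReal (laplaceKernel b x) *
        ENNReal.ofReal (∫ s, Real.exp (-(s * x)) ∂τ) =
      ∫⁻ s, ENNReal.ofReal (s + b)⁻¹
        ∂τ.withDensity fun s => ENNReal.ofReal (s * (s + 1))⁻¹ := by
  have hinteg : ∀ x ∈ Ioi (0 : ℝ), Integrable (fun s => Real.exp (-(s * x))) τ := fun x hx => by
    refine .of_bound (C := 1) (by fun_prop) (hτ.mono fun s hs => ?_)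
    rw [Real.norm_of_nonneg (Real.exp_pos _).le, Real.exp_le_one_iff]
    exact neg_nonpos.2 (mul_pos hs hx).le
  have hK := measurable_laplaceKernel b
  calc ∫⁻ x in Ioi 0, ENNReal.ofReal (laplaceKernel b x) *
          ENNReal.ofReal (∫ s, Real.exp (-(s * x)) ∂τ)
      = ∫⁻ x in Ioi 0, ∫⁻ s, ENNReal.ofReal (laplaceKernel b x * Real.exp (-(s * x))) ∂τ := by
        refine setLIntegral_congr_fun measurableSet_Ioi fun x hx => ?_
        simp_rw [ENNReal.ofReal_mul (laplaceKernel_nonneg hb x)]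
        rw [lintegral_const_mul _ (by fun_prop), ofReal_integral_eq_lintegral_ofReal (hinteg x hx)
          (Eventually.of_forall fun s => (Real.exp_pos _).le)]
    _ = ∫⁻ s, ENNReal.ofReal ((s * (s + 1))⁻¹ * (s + b)⁻¹) ∂τ := by
        rw [lintegral_lintegral_swap (by fun_prop)]
        exact lintegral_congr_ae (hτ.mono fun s hs => lintegral_laplaceKernel_mul_exp hs hb hb1)
    _ = _ := by
        rw [lintegral_withDensity_eq_lintegral_mul _ (by fun_prop) (by fun_prop)]
        refine lintegral_congr_ae (hτ.mono fun s hs => ?_)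
        have hinv : 0 ≤ (s * (s + 1))⁻¹ := by positivity
        simp only [Pi.mul_apply, ENNReal.ofReal_mul hinv]

namespace IsCompletelyMonotone

variable {f : ℝ → ℝ}

theorem exists_isStieltjes_shift (hf : IsCompletelyMonotone f) (h0 : Tendsto f atTop (𝓝 0)) {ε : ℝ}
    (hε : 0 < ε)
    (hfin : ∫⁻ x in Ioi 0, ENNReal.ofReal (laplaceKernel 2 x) * ENNReal.ofReal (f (ε + x)) ≠ ∞) :
    ∃ R, IsStieltjes R ∧ ∀ b, 0 < b → b ≠ 1 → R b =
      (∫⁻ x in Ioi 0, ENNReal.ofReal (laplaceKernel b x) * ENNReal.ofReal (f (ε + x))).toReal := by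
  obtain ⟨τ, hτfin, hτ, hf_eq⟩ := hf.exists_eq_integral_exp h0 hε
  have hkernel : ∀ b, 0 < b → b ≠ 1 →
      ∫⁻ x in Ioi 0, ENNReal.ofReal (laplaceKernel b x) * ENNReal.ofReal (f (ε + x)) =
        ∫⁻ s, ENNReal.ofReal (s + b)⁻¹
          ∂τ.withDensity fun s => ENNReal.ofReal (s * (s + 1))⁻¹ := fun b hb hb1 => by
    rw [← lintegral_laplaceKernel_mul_integral_exp hτ hb hb1]
    exact setLIntegral_congr_fun measurableSet_Ioi fun x hx => by simp only [hf_eq x hx]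
  rw [hkernel 2 two_pos (by norm_num)] at hfin
  exact ⟨_, isStieltjes_lintegral_inv_add
    ((withDensity_absolutelyContinuous τ _).ae_le (hτ.mono fun s => le_of_lt)) two_pos hfin,
    fun b hb hb1 => by rw [hkernel b hb hb1]⟩

theorem exists_isStieltjes (hf : IsCompletelyMonotone f) (h0 : Tendsto f atTop (𝓝 0))
    (hfin : ∀ b, 0 < b →
      ∫⁻ x in Ioi 0, ENNReal.ofReal (laplaceKernel b x) * ENNReal.ofReal (f x) ≠ ∞) :
    ∃ R, IsStieltjes R ∧ ∀ b, 0 < b → b ≠ 1 → R b =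
      (∫⁻ x in Ioi 0, ENNReal.ofReal (laplaceKernel b x) * ENNReal.ofReal (f x)).toReal := by
  let ε : ℕ → ℝ := fun n => 1 / ((n : ℝ) + 1)
  have hε : ∀ n, 0 < ε n := fun n => by positivity
  have hε_anti : Antitone ε := fun m n h => one_div_le_one_div_of_le (by positivity) (by gcongr)
  have hcont : ∀ n, ContinuousOn (fun x => f (ε n + x)) (Ioi 0) := fun n =>
    hf.continuousOn.comp (by fun_prop) fun x hx => add_pos (hε n) hx
  have hle : ∀ n, ∫⁻ x in Ioi 0, ENNReal.ofReal (laplaceKernel 2 x) *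
      ENNReal.ofReal (f (ε n + x)) ≤
        ∫⁻ x in Ioi 0, ENNReal.ofReal (laplaceKernel 2 x) * ENNReal.ofReal (f x) := by
    refine fun n => setLIntegral_mono' measurableSet_Ioi fun x hx => ?_
    gcongr
    exact hf.antitoneOn hx (add_pos (hε n) hx) (by linarith [hε n])
  choose R hR hR_eq using fun n => hf.exists_isStieltjes_shift h0 (hε n)
    (ne_top_of_le_ne_top (hfin 2 two_pos) (hle n))
  obtain ⟨S, hS, hS_eq⟩ := IsStieltjes.exists_of_tendsto (s := Ioi 0 \ {1}) sdiff_subset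
    ⟨2, by norm_num⟩ hR fun b hb => by
      simp_rw [fun n => hR_eq n b hb.1 hb.2]
      refine (ENNReal.tendsto_toReal (hfin b hb.1)).comp
        (lintegral_tendsto_of_tendsto_of_monotone (fun n => ?_) ?_ ?_)
      · exact (measurable_laplaceKernel b).ennreal_ofReal.aemeasurable.mul
          ((hcont n).aemeasurable measurableSet_Ioi).ennreal_ofReal
      · filter_upwards [ae_restrict_mem measurableSet_Ioi] with x hx m n hmn
        beta_reduce
        gcongr
        exact hf.antitoneOn (add_pos (hε n) hx) (add_pos (hε m) hx) (by linarith [hε_anti hmn])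
      · filter_upwards [ae_restrict_mem measurableSet_Ioi] with x hx
        refine ENNReal.Tendsto.const_mul ((ENNReal.continuous_ofReal.tendsto _).comp ?_)
          (Or.inr ENNReal.ofReal_ne_top)
        have hshift : Tendsto (fun n => ε n + x) atTop (𝓝 x) := by
          simpa [ε] using (tendsto_one_div_add_atTop_nhds_zero_nat (𝕜 := ℝ)).add_const x
        exact (hf.continuousOn.continuousAt (Ioi_mem_nhds hx)).tendsto.comp hshift
  exact ⟨S, hS, fun b hb hb1 => hS_eq ⟨hb, hb1⟩⟩

end IsCompletelyMonotone

/-! ### Compound Poisson laws and Lévy measures -/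

/-- The `k`-fold convolution power of `η`. -/
noncomputable def convPow (η : Measure ℝ) : ℕ → Measure ℝ
  | 0 => Measure.dirac 0
  | k + 1 => Measure.conv (convPow η k) η

/-- The compound Poisson law with finite jump measure `η`, i.e. the exponential
`e^{-η(ℝ)} ∑ η^{*k} / k!` in the convolution algebra. -/
noncomputable def compoundPoisson (η : Measure ℝ) : Measure ℝ :=
  Measure.sum fun k : ℕ => ENNReal.ofReal (Real.exp (-η.real univ) / k.factorial) • convPow η k

section CompoundPoisson

variable (η : Measure ℝ)

theorem lintegral_exp_conv (η' : Measure ℝ) [SFinite η'] (l : ℝ) :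
    ∫⁻ x, ENNReal.ofReal (Real.exp (l * x)) ∂(Measure.conv η η') =
      (∫⁻ x, ENNReal.ofReal (Real.exp (l * x)) ∂η) *
        ∫⁻ x, ENNReal.ofReal (Real.exp (l * x)) ∂η' := by
  rw [Measure.lintegral_conv (by fun_prop), ← lintegral_mul_const _ (by fun_prop)]
  refine lintegral_congr fun x => ?_
  rw [← lintegral_const_mul _ (by fun_prop)]
  refine lintegral_congr fun y => ?_
  rw [← ENNReal.ofReal_mul (Real.exp_pos _).le, ← Real.exp_add, mul_add]

variable [IsFiniteMeasure η]

instance isFiniteMeasure_convPow (k : ℕ) : IsFiniteMeasure (convPow η k) := by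
  induction k with
  | zero => unfold convPow; infer_instance
  | succ k ih => unfold convPow; infer_instance

theorem charFun_convPow (k : ℕ) (θ : ℝ) : charFun (convPow η k) θ = charFun η θ ^ k := by
  induction k with
  | zero => simp [convPow]
  | succ k ih => rw [convPow, charFun_conv, ih, pow_succ]

theorem lintegral_exp_convPow (k : ℕ) (l : ℝ) :
    ∫⁻ x, ENNReal.ofReal (Real.exp (l * x)) ∂(convPow η k) =
      (∫⁻ x, ENNReal.ofReal (Real.exp (l * x)) ∂η) ^ k := by
  induction k with
  | zero => simp [convPow, lintegral_dirac' (0 : ℝ)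
      (show Measurable fun x => ENNReal.ofReal (Real.exp (l * x)) by fun_prop)]
  | succ k ih => rw [convPow, lintegral_exp_conv, ih, pow_succ]

theorem lintegral_exp_compoundPoisson {l : ℝ} (hl : Integrable (fun x => Real.exp (l * x)) η) :
    ∫⁻ x, ENNReal.ofReal (Real.exp (l * x)) ∂(compoundPoisson η) =
      ENNReal.ofReal (Real.exp ((∫ x, Real.exp (l * x) ∂η) - η.real univ)) := by
  set L := ∫ x, Real.exp (l * x) ∂η
  have hL : 0 ≤ L := integral_nonneg fun x => (Real.exp_pos _).le
  have hseries : HasSum (fun k : ℕ => Real.exp (-η.real univ) / k.factorial * L ^ k)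
      (Real.exp (L - η.real univ)) := by
    have hexp := (NormedSpace.expSeries_div_hasSum_exp L).mul_left (Real.exp (-η.real univ))
    rw [← Real.exp_eq_exp_ℝ, ← Real.exp_add, neg_add_eq_sub] at hexp
    simpa only [div_mul_eq_mul_div, mul_div_assoc] using hexp
  simp_rw [compoundPoisson, lintegral_sum_measure, lintegral_smul_measure, lintegral_exp_convPow,
    smul_eq_mul]
  rw [← ofReal_integral_eq_lintegral_ofReal hl (Eventually.of_forall fun x => (Real.exp_pos _).le),
    ← hseries.tsum_eq, ENNReal.ofReal_tsum_of_nonneg (fun k => by positivity) hseries.summable]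
  exact tsum_congr fun k => by rw [ENNReal.ofReal_mul (by positivity), ENNReal.ofReal_pow hL]

instance isProbabilityMeasure_compoundPoisson : IsProbabilityMeasure (compoundPoisson η) :=
  ⟨by simpa using lintegral_exp_compoundPoisson η (l := 0) (by simp)⟩

theorem charFun_compoundPoisson (θ : ℝ) :
    charFun (compoundPoisson η) θ = Complex.exp (charFun η θ - η.real univ) := by
  have hinteg : Integrable (fun x : ℝ => Complex.exp (θ * x * Complex.I)) (compoundPoisson η) := by
    refine .of_bound (C := 1) (by fun_prop) (Eventually.of_forall fun x => ?_)
    rw [← Complex.ofReal_mul, Complex.norm_exp_ofReal_mul_I]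
  have hseries := (NormedSpace.expSeries_div_hasSum_exp (charFun η θ)).mul_left
    (Complex.exp (-(η.real univ : ℂ)))
  rw [← Complex.exp_eq_exp_ℂ, ← Complex.exp_add, neg_add_eq_sub] at hseries
  rw [charFun_apply_real]
  refine (hasSum_integral_measure hinteg).unique (hseries.congr_fun fun k => ?_)
  rw [integral_smul_measure, ENNReal.toReal_ofReal (by positivity), ← charFun_apply_real,
    charFun_convPow, Complex.real_smul]
  push_cast
  ring

theorem integrable_ite_abs_lt_one : Integrable (fun x : ℝ => if |x| < 1 then x else 0) η := by
  refine .of_bound (C := 1) (Measurable.aestronglyMeasurable (Measurable.ite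
    (measurableSet_lt (by fun_prop) measurable_const) measurable_id measurable_const))
    (Eventually.of_forall fun x => ?_)
  split_ifs with h
  · exact h.le
  · simp

end CompoundPoisson

/-- The Laplace exponent with triplet `(μ, σ, ν)`, i.e. the Lévy-Khintchine formula continued to
imaginary arguments: `levyLaplaceExponent μ σ ν l = -Ψ(-i l)`. -/
noncomputable def levyLaplaceExponent (μ σ : ℝ) (ν : Measure ℝ) (l : ℝ) : ℝ :=
  -μ * l + σ ^ 2 / 2 * l ^ 2 + ∫ x, (Real.exp (l * x) - 1 - (if |x| < 1 then l * x else 0)) ∂ν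

/-- The infinitely divisible law with triplet `(μ, σ, η)` for a finite measure `η`: the convolution
of a Gaussian and a compound Poisson law. -/
noncomputable def levyLaw (μ σ : ℝ) (η : Measure ℝ) : Measure ℝ :=
  Measure.conv (gaussianReal (-μ - ∫ x, (if |x| < 1 then x else 0) ∂η) (σ ^ 2).toNNReal)
    (compoundPoisson η)

section LevyLaw

variable (μ σ : ℝ) (η : Measure ℝ) [IsFiniteMeasure η]

instance isProbabilityMeasure_levyLaw : IsProbabilityMeasure (levyLaw μ σ η) := by
  unfold levyLaw
  infer_instance

theorem charFun_levyLaw (θ : ℝ) :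
    charFun (levyLaw μ σ η) θ = Complex.exp (-levyKhintchineExponent μ σ η θ) := by
  have hexp : Integrable (fun x : ℝ => Complex.exp (Complex.I * θ * x)) η := by
    refine .of_bound (C := 1) (by fun_prop) (Eventually.of_forall fun x => ?_)
    rw [mul_assoc, ← Complex.ofReal_mul, mul_comm, Complex.norm_exp_ofReal_mul_I]
  have hsub : Integrable (fun x : ℝ => 1 - Complex.exp (Complex.I * θ * x)) η :=
    (integrable_const _).sub hexp
  have hcomp : Integrable
      (fun x : ℝ => Complex.I * θ * ((if |x| < 1 then x else 0 : ℝ) : ℂ)) η :=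
    (integrable_ite_abs_lt_one η).ofReal.const_mul _
  have hite : ∀ x : ℝ, (if |x| < 1 then Complex.I * θ * x else 0) =
      Complex.I * θ * ((if |x| < 1 then x else 0 : ℝ) : ℂ) := fun x => by split_ifs <;> simp
  have hcharFun : charFun η θ = ∫ x : ℝ, Complex.exp (Complex.I * θ * x) ∂η := by
    rw [charFun_apply_real]
    exact integral_congr_ae (Eventually.of_forall fun x => by ring_nf)
  rw [levyLaw, charFun_conv, charFun_gaussianReal, charFun_compoundPoisson, ← Complex.exp_add,
    levyKhintchineExponent]
  simp_rw [hite]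
  rw [integral_add hsub hcomp, integral_sub (integrable_const _) hexp, integral_const_mul,
    integral_complex_ofReal, hcharFun, integral_const, Real.coe_toNNReal _ (sq_nonneg σ),
    Complex.real_smul]
  congr 1
  push_cast
  ring

variable {η} {l : ℝ} (hl : Integrable (fun x => Real.exp (l * x)) η)
include hl

theorem lintegral_exp_levyLaw :
    ∫⁻ x, ENNReal.ofReal (Real.exp (l * x)) ∂(levyLaw μ σ η) =
      ENNReal.ofReal (Real.exp (levyLaplaceExponent μ σ η l)) := by
  have hgauss := congrFun (mgf_id_gaussianReal
    (μ := -μ - ∫ x, (if |x| < 1 then x else 0) ∂η) (v := (σ ^ 2).toNNReal)) l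
  simp only [mgf, id] at hgauss
  have hsub : Integrable (fun x => Real.exp (l * x) - 1) η := hl.sub (integrable_const _)
  rw [levyLaw, lintegral_exp_conv, lintegral_exp_compoundPoisson η hl,
    ← ofReal_integral_eq_lintegral_ofReal (integrable_exp_mul_gaussianReal l)
      (Eventually.of_forall fun x => (Real.exp_pos _).le), hgauss,
    ← ENNReal.ofReal_mul (Real.exp_pos _).le, ← Real.exp_add, levyLaplaceExponent]
  simp_rw [← mul_ite_zero]
  rw [integral_sub hsub ((integrable_ite_abs_lt_one η).const_mul _),
    integral_sub hl (integrable_const _), integral_const_mul, integral_const,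
    Real.coe_toNNReal _ (sq_nonneg σ), smul_eq_mul, mul_one]
  congr 2
  ring

theorem integrable_exp_levyLaw : Integrable (fun x => Real.exp (l * x)) (levyLaw μ σ η) := by
  rw [← lintegral_ofReal_ne_top_iff_integrable (by fun_prop)
    (Eventually.of_forall fun x => (Real.exp_pos _).le), lintegral_exp_levyLaw μ σ hl]
  exact ENNReal.ofReal_ne_top

theorem integral_exp_levyLaw :
    ∫ x, Real.exp (l * x) ∂(levyLaw μ σ η) = Real.exp (levyLaplaceExponent μ σ η l) := by
  rw [integral_eq_lintegral_of_nonneg_ae (Eventually.of_forall fun x => (Real.exp_pos _).le)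
    (by fun_prop), lintegral_exp_levyLaw μ σ hl, ENNReal.toReal_ofReal (Real.exp_pos _).le]

end LevyLaw

theorem norm_one_sub_exp_I_mul_add_le (y : ℝ) :
    ‖1 - Complex.exp (Complex.I * y) + Complex.I * y‖ ≤ 2 * y ^ 2 := by
  have hnorm : ‖Complex.I * (y : ℂ)‖ = |y| := by
    rw [norm_mul, Complex.norm_I, one_mul, Complex.norm_real, Real.norm_eq_abs]
  have hneg : 1 - Complex.exp (Complex.I * y) + Complex.I * y =
      -(Complex.exp (Complex.I * y) - 1 - Complex.I * y) := by ring
  rw [hneg, norm_neg]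
  rcases le_or_gt |y| 1 with hy | hy
  · refine (Complex.norm_exp_sub_one_sub_id_le (hnorm.trans_le hy)).trans ?_
    rw [hnorm, sq_abs]
    nlinarith [sq_nonneg y]
  · have hexp : ‖Complex.exp (Complex.I * y) - 1‖ ≤ |y| := Real.norm_exp_I_mul_ofReal_sub_one_le
    refine (norm_sub_le _ _).trans ?_
    rw [hnorm, ← sq_abs]
    nlinarith

theorem abs_exp_sub_one_sub_id_le_of_nonpos {y : ℝ} (hy : y ≤ 0) :
    |Real.exp y - 1 - y| ≤ y ^ 2 := by
  rcases le_or_gt |y| 1 with h | h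
  · exact Real.abs_exp_sub_one_sub_id_le h
  · rw [abs_of_nonpos hy] at h
    rw [abs_le]
    constructor <;> nlinarith [Real.exp_pos y, Real.exp_le_one_iff.2 hy]

namespace IsLevyMeasure

variable {ν : Measure ℝ}

theorem integrable_of_norm_le (hν : IsLevyMeasure ν) {E : Type*} [NormedAddCommGroup E]
    {g : ℝ → E} (hg : AEStronglyMeasurable g ν) {C : ℝ}
    (hsmall : ∀ᵐ x ∂ν, |x| < 1 → ‖g x‖ ≤ C * x ^ 2) (hlarge : ∀ᵐ x ∂ν, 1 ≤ |x| → ‖g x‖ ≤ C) :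
    Integrable g ν := by
  have hmin : Integrable (fun x : ℝ => min 1 (x ^ 2)) ν := by
    refine ⟨by fun_prop, ?_⟩
    rw [hasFiniteIntegral_iff_ofReal (Eventually.of_forall fun x => by positivity)]
    exact hν.lintegral_lt_top
  refine (hmin.const_mul C).mono' hg ?_
  filter_upwards [hsmall, hlarge] with x hx hx'
  rcases lt_or_ge |x| 1 with h | h
  · rw [min_eq_right ((sq_le_one_iff_abs_le_one x).2 h.le)]
    exact hx h
  · rw [min_eq_left ((one_le_sq_iff_one_le_abs x).2 h), mul_one]
    exact hx' h

theorem integrable_levyKhintchine (hν : IsLevyMeasure ν) (θ : ℝ) :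
    Integrable (fun x : ℝ => 1 - Complex.exp (Complex.I * θ * x) +
      (if |x| < 1 then Complex.I * θ * x else 0)) ν := by
  have hmeas : Measurable fun x : ℝ => if |x| < 1 then Complex.I * θ * (x : ℂ) else 0 :=
    Measurable.ite (measurableSet_lt (by fun_prop) measurable_const) (by fun_prop) measurable_const
  have hcast : ∀ x : ℝ, Complex.I * θ * x = Complex.I * ((θ * x : ℝ) : ℂ) := fun x => by
    push_cast; ring
  refine hν.integrable_of_norm_le (C := 2 * θ ^ 2 + 2)
    (Measurable.aestronglyMeasurable (by fun_prop)) (Eventually.of_forall fun x hx => ?_)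
    (Eventually.of_forall fun x hx => ?_)
  · rw [if_pos hx, hcast]
    refine (norm_one_sub_exp_I_mul_add_le _).trans ?_
    nlinarith [sq_nonneg x]
  · rw [if_neg hx.not_gt, add_zero, hcast]
    refine (norm_sub_le _ _).trans ?_
    rw [norm_one, mul_comm Complex.I, Complex.norm_exp_ofReal_mul_I]
    nlinarith [sq_nonneg θ]

theorem ae_neg (hν : IsLevyMeasure ν) (h0 : ν (Ioi 0) = 0) : ∀ᵐ x ∂ν, x < 0 := by
  have hcompl : {x : ℝ | ¬ x < 0} = {0} ∪ Ioi 0 := by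
    ext x
    simp [le_iff_eq_or_lt, eq_comm]
  rw [ae_iff, hcompl]
  exact measure_union_null hν.zero h0

theorem integrable_laplace (hν : IsLevyMeasure ν) (h0 : ν (Ioi 0) = 0) {l : ℝ} (hl : 0 ≤ l) :
    Integrable (fun x : ℝ => Real.exp (l * x) - 1 - (if |x| < 1 then l * x else 0)) ν := by
  have hmeas : Measurable fun x : ℝ => if |x| < 1 then l * x else 0 :=
    Measurable.ite (measurableSet_lt (by fun_prop) measurable_const) (by fun_prop) measurable_const
  have hnonpos : ∀ᵐ x ∂ν, l * x ≤ 0 :=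
    (hν.ae_neg h0).mono fun x hx => mul_nonpos_of_nonneg_of_nonpos hl hx.le
  refine hν.integrable_of_norm_le (C := l ^ 2 + 1)
    (Measurable.aestronglyMeasurable (by fun_prop)) (hnonpos.mono fun x hlx hx => ?_)
    (hnonpos.mono fun x hlx hx => ?_)
  · rw [if_pos hx, Real.norm_eq_abs]
    refine (abs_exp_sub_one_sub_id_le_of_nonpos hlx).trans ?_
    nlinarith [sq_nonneg x]
  · rw [if_neg hx.not_gt, sub_zero, Real.norm_eq_abs, abs_le]
    constructor <;> nlinarith [Real.exp_pos (l * x), Real.exp_le_one_iff.2 hlx, sq_nonneg l]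

theorem isFiniteMeasure_restrict_Iic (hν : IsLevyMeasure ν) {δ : ℝ} (hδ : 0 < δ) :
    IsFiniteMeasure (ν.restrict (Iic (-δ))) := by
  have hmarkov := meas_ge_le_lintegral_div (μ := ν)
    (f := fun x : ℝ => ENNReal.ofReal (min 1 (x ^ 2))) (by fun_prop)
    (ε := ENNReal.ofReal (min 1 (δ ^ 2))) (by simpa using hδ.ne') ENNReal.ofReal_ne_top
  refine ⟨?_⟩
  rw [Measure.restrict_apply_univ]
  refine ((measure_mono fun x hx => ?_).trans hmarkov).trans_lt
    (ENNReal.div_lt_top hν.lintegral_lt_top.ne (by simpa using hδ.ne'))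
  have hx' : x ≤ -δ := hx
  exact ENNReal.ofReal_le_ofReal (min_le_min_left _ (by nlinarith))

theorem tendsto_setIntegral_Iic (hν : IsLevyMeasure ν) (h0 : ν (Ioi 0) = 0) {E : Type*}
    [NormedAddCommGroup E] [NormedSpace ℝ E] {g : ℝ → E} (hg : Integrable g ν) :
    Tendsto (fun n : ℕ => ∫ x in Iic (-(1 / ((n : ℝ) + 1))), g x ∂ν) atTop (𝓝 (∫ x, g x ∂ν)) := by
  have hmono : Monotone fun n : ℕ => Iic (-(1 / ((n : ℝ) + 1))) := fun m n hmn =>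
    Iic_subset_Iic.2 (neg_le_neg (one_div_le_one_div_of_le (by positivity) (by gcongr)))
  have hunion : ∫ x in ⋃ n : ℕ, Iic (-(1 / ((n : ℝ) + 1))), g x ∂ν = ∫ x, g x ∂ν := by
    rw [Measure.restrict_eq_self_of_ae_mem]
    refine (hν.ae_neg h0).mono fun x hx => ?_
    obtain ⟨n, hn⟩ := exists_nat_one_div_lt (neg_pos.2 hx)
    exact mem_iUnion.2 ⟨n, by rw [mem_Iic]; linarith⟩
  rw [← hunion]
  exact tendsto_setIntegral_of_monotone (fun _ => measurableSet_Iic) hmono hg.integrableOn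

theorem smul (hν : IsLevyMeasure ν) (t : ℝ≥0) : IsLevyMeasure (t • ν) := by
  refine ⟨by simp [hν.zero], ?_⟩
  have hsmul : ∫⁻ x, ENNReal.ofReal (min 1 (x ^ 2)) ∂(t • ν) =
      t * ∫⁻ x, ENNReal.ofReal (min 1 (x ^ 2)) ∂ν := by
    rw [← smul_eq_mul, ← lintegral_smul_measure]
    rfl
  rw [hsmul]
  exact ENNReal.mul_lt_top ENNReal.coe_lt_top hν.lintegral_lt_top

end IsLevyMeasure

theorem sub_sq_div_le_min {a K : ℝ} (hK : 0 < K) : a - a ^ 2 / K ≤ min a K := by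
  refine le_min (sub_le_self _ (by positivity)) ?_
  rw [sub_le_iff_le_add, ← sub_le_iff_le_add', le_div_iff₀ hK]
  nlinarith [sq_nonneg (a - K)]

theorem integrable_and_integral_eq_of_tendsto_integral_min {α : Type*} [MeasurableSpace α]
    {m : Measure α} [IsFiniteMeasure m] {f : α → ℝ} (hf : Measurable f) (hf0 : ∀ x, 0 ≤ f x) {c : ℝ}
    (h : Tendsto (fun K : ℕ => ∫ x, min (f x) K ∂m) atTop (𝓝 c)) :
    Integrable f m ∧ ∫ x, f x ∂m = c := by
  have hmin0 : ∀ (K : ℕ) x, 0 ≤ min (f x) K := fun K x => le_min (hf0 x) K.cast_nonneg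
  have hmin : ∀ K : ℕ, Integrable (fun x => min (f x) K) m := fun K =>
    .of_bound (C := K) (Measurable.aestronglyMeasurable (by fun_prop))
      (Eventually.of_forall fun x => by
        rw [Real.norm_of_nonneg (hmin0 K x)]
        exact min_le_right _ _)
  have hmct : Tendsto (fun K : ℕ => ∫⁻ x, ENNReal.ofReal (min (f x) K) ∂m) atTop
      (𝓝 (∫⁻ x, ENNReal.ofReal (f x) ∂m)) := by
    refine lintegral_tendsto_of_tendsto_of_monotone (fun K => by fun_prop)
      (Eventually.of_forall fun x K K' hKK => ?_) (Eventually.of_forall fun x => ?_)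
    · exact ENNReal.ofReal_le_ofReal (min_le_min_left _ (by gcongr))
    · refine tendsto_const_nhds.congr' ?_
      filter_upwards [eventually_ge_atTop ⌈f x⌉₊] with K hK
      rw [min_eq_left (Nat.ceil_le.1 hK)]
  have hlintegral : ∫⁻ x, ENNReal.ofReal (f x) ∂m = ENNReal.ofReal c :=
    tendsto_nhds_unique hmct (((ENNReal.continuous_ofReal.tendsto _).comp h).congr fun K =>
      ofReal_integral_eq_lintegral_ofReal (hmin K) (Eventually.of_forall (hmin0 K)))
  have hc : 0 ≤ c := ge_of_tendsto' h fun K => integral_nonneg (hmin0 K)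
  constructor
  · rw [← lintegral_ofReal_ne_top_iff_integrable hf.aestronglyMeasurable
      (Eventually.of_forall hf0), hlintegral]
    exact ENNReal.ofReal_ne_top
  · rw [integral_eq_lintegral_of_nonneg_ae (Eventually.of_forall hf0) hf.aestronglyMeasurable,
      hlintegral, ENNReal.toReal_ofReal hc]

theorem integrable_and_integral_eq_of_tendsto_of_sq_le {α : Type*} [TopologicalSpace α]
    [MeasurableSpace α] [OpensMeasurableSpace α] {m : ProbabilityMeasure α}
    {Y : ℕ → ProbabilityMeasure α} (hY : Tendsto Y atTop (𝓝 m)) {f : α → ℝ} (hf : Continuous f)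
    (hf0 : ∀ x, 0 ≤ f x) {c C : ℝ} (hinteg : ∀ n, Integrable f (Y n : Measure α))
    (hinteg_sq : ∀ n, Integrable (fun x => f x ^ 2) (Y n : Measure α))
    (hsq : ∀ n, ∫ x, f x ^ 2 ∂(Y n : Measure α) ≤ C)
    (hc : Tendsto (fun n => ∫ x, f x ∂(Y n : Measure α)) atTop (𝓝 c)) :
    Integrable f (m : Measure α) ∧ ∫ x, f x ∂(m : Measure α) = c := by
  have hbound : ∀ (K : ℕ) x, ‖min (f x) K‖ ≤ K := fun K x => by
    rw [Real.norm_of_nonneg (le_min (hf0 x) K.cast_nonneg)]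
    exact min_le_right _ _
  have hmin : ∀ (K : ℕ) n, Integrable (fun x => min (f x) K) (Y n : Measure α) := fun K n =>
    .of_bound (C := K) ((hf.measurable.min measurable_const).aestronglyMeasurable)
      (Eventually.of_forall (hbound K))
  have htrunc : ∀ K : ℕ, Tendsto (fun n => ∫ x, min (f x) K ∂(Y n : Measure α)) atTop
      (𝓝 (∫ x, min (f x) K ∂(m : Measure α))) := fun K =>
    (ProbabilityMeasure.tendsto_iff_forall_integral_tendsto.1 hY)
      (BoundedContinuousFunction.ofNormedAddCommGroup (fun x => min (f x) (K : ℝ))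
        (by fun_prop) K (hbound K))
  have hupper : ∀ K : ℕ, ∫ x, min (f x) K ∂(m : Measure α) ≤ c := fun K =>
    le_of_tendsto_of_tendsto' (htrunc K) hc fun n =>
      integral_mono (hmin K n) (hinteg n) fun x => min_le_left _ _
  have hlower : ∀ K : ℕ, 0 < K → c - C / K ≤ ∫ x, min (f x) K ∂(m : Measure α) := fun K hK => by
    have hK' : (0 : ℝ) < K := by exact_mod_cast hK
    refine le_of_tendsto_of_tendsto' (hc.sub_const _) (htrunc K) fun n => ?_
    calc ∫ x, f x ∂(Y n : Measure α) - C / K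
        ≤ ∫ x, f x ∂(Y n : Measure α) - (∫ x, f x ^ 2 ∂(Y n : Measure α)) / K := by
          gcongr
          exact hsq n
      _ = ∫ x, (f x - f x ^ 2 / K) ∂(Y n : Measure α) := by
          rw [integral_sub (hinteg n) ((hinteg_sq n).div_const _), integral_div]
      _ ≤ ∫ x, min (f x) K ∂(Y n : Measure α) :=
          integral_mono ((hinteg n).sub ((hinteg_sq n).div_const _)) (hmin K n) fun x =>
            sub_sq_div_le_min hK'
  refine integrable_and_integral_eq_of_tendsto_integral_min hf.measurable hf0 ?_
  refine tendsto_of_tendsto_of_tendsto_of_le_of_le' ?_ tendsto_const_nhds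
    ((eventually_gt_atTop 0).mono hlower) (Eventually.of_forall hupper)
  simpa using (tendsto_const_div_atTop_nhds_zero_nat C).const_sub c

theorem integrable_and_integral_exp_eq_of_charFun {ν : Measure ℝ} (hν : IsLevyMeasure ν)
    (h0 : ν (Ioi 0) = 0) {μ σ : ℝ} {m : Measure ℝ} [IsProbabilityMeasure m]
    (hm : ∀ θ : ℝ, charFun m θ = Complex.exp (-levyKhintchineExponent μ σ ν θ)) {l : ℝ}
    (hl : 0 ≤ l) :
    Integrable (fun x => Real.exp (l * x)) m ∧
      ∫ x, Real.exp (l * x) ∂m = Real.exp (levyLaplaceExponent μ σ ν l) := by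
  let η : ℕ → Measure ℝ := fun n => ν.restrict (Iic (-(1 / ((n : ℝ) + 1))))
  have hη : ∀ n, IsFiniteMeasure (η n) := fun n =>
    hν.isFiniteMeasure_restrict_Iic (by positivity)
  let Y : ℕ → ProbabilityMeasure ℝ := fun n => ⟨levyLaw μ σ (η n), inferInstance⟩
  have hY : Tendsto Y atTop (𝓝 ⟨m, inferInstance⟩) := by
    refine ProbabilityMeasure.tendsto_of_tendsto_charFun fun θ => ?_
    change Tendsto (fun n => charFun (levyLaw μ σ (η n)) θ) atTop (𝓝 (charFun m θ))
    simp_rw [charFun_levyLaw, hm]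
    refine (Complex.continuous_exp.tendsto _).comp (Tendsto.neg ?_)
    exact (hν.tendsto_setIntegral_Iic h0 (hν.integrable_levyKhintchine θ)).const_add _
  have hexp : ∀ n {b : ℝ}, 0 ≤ b → Integrable (fun x => Real.exp (b * x)) (η n) := by
    refine fun n b hb => .of_bound (C := 1) (by fun_prop)
      ((ae_restrict_mem measurableSet_Iic).mono fun x hx => ?_)
    have hx' : x ≤ 0 := le_trans (show x ≤ _ from hx) (neg_nonpos.2 (by positivity))
    rw [Real.norm_of_nonneg (Real.exp_pos _).le, Real.exp_le_one_iff]
    exact mul_nonpos_of_nonneg_of_nonpos hb hx'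
  have hlim : ∀ {b : ℝ}, 0 ≤ b → Tendsto (fun n => ∫ x, Real.exp (b * x) ∂(Y n : Measure ℝ)) atTop
      (𝓝 (Real.exp (levyLaplaceExponent μ σ ν b))) := fun {b} hb => by
    refine Tendsto.congr (fun n => (integral_exp_levyLaw μ σ (hexp n hb)).symm) ?_
    exact (Real.continuous_exp.tendsto _).comp
      ((hν.tendsto_setIntegral_Iic h0 (hν.integrable_laplace h0 hb)).const_add _)
  have hsq : (fun x => Real.exp (l * x) ^ 2) = fun x => Real.exp (2 * l * x) := by
    ext x
    rw [← Real.exp_nat_mul, Nat.cast_ofNat, mul_assoc]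
  have h2l : 0 ≤ 2 * l := by positivity
  obtain ⟨C, hC⟩ := (hlim h2l).bddAbove_range
  refine integrable_and_integral_eq_of_tendsto_of_sq_le (C := C) hY (by fun_prop)
    (fun x => (Real.exp_pos _).le) (fun n => integrable_exp_levyLaw μ σ (hexp n hl))
    (fun n => ?_) (fun n => ?_) (hlim hl) <;> rw [hsq]
  · exact integrable_exp_levyLaw μ σ (hexp n h2l)
  · exact hC (mem_range_self n)

theorem levyKhintchineExponent_smul (t : ℝ≥0) (μ σ : ℝ) (ν : Measure ℝ) (θ : ℝ) :
    levyKhintchineExponent (t * μ) (√t * σ) (t • ν) θ = t * levyKhintchineExponent μ σ ν θ := by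
  have hsqrt : ((√t : ℝ) : ℂ) ^ 2 = ((t : ℝ) : ℂ) := by
    rw [← Complex.ofReal_pow, Real.sq_sqrt t.coe_nonneg]
  rw [levyKhintchineExponent, levyKhintchineExponent, integral_smul_nnreal_measure]
  push_cast
  rw [mul_pow, hsqrt, NNReal.smul_def, Complex.real_smul]
  ring

theorem levyLaplaceExponent_smul (t : ℝ≥0) (μ σ : ℝ) (ν : Measure ℝ) (l : ℝ) :
    levyLaplaceExponent (t * μ) (√t * σ) (t • ν) l = t * levyLaplaceExponent μ σ ν l := by
  rw [levyLaplaceExponent, levyLaplaceExponent, integral_smul_nnreal_measure, mul_pow,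
    Real.sq_sqrt t.coe_nonneg, NNReal.smul_def, smul_eq_mul]
  ring

theorem antitone_of_antitoneOn_dense {α β : Type*} [LinearOrder α] [TopologicalSpace α]
    [OrderTopology α] [DenselyOrdered α] [NoMaxOrder α] [Preorder β] [TopologicalSpace β]
    [OrderClosedTopology β] {g : α → β} {D : Set α} (hg : AntitoneOn g D) (hD : Dense D)
    (hright : ∀ t, ContinuousWithinAt g (Ici t) t) : Antitone g := by
  have hne : ∀ t, (𝓝[Ioi t ∩ D] t).NeBot := fun t => by
    have hsub := closure_mono (hD.open_subset_closure_inter (isOpen_Ioi (a := t)))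
    rw [closure_closure, closure_Ioi] at hsub
    exact mem_closure_iff_nhdsWithin_neBot.1 (hsub self_mem_Ici)
  have hlim : ∀ t, Tendsto g (𝓝[Ioi t ∩ D] t) (𝓝 (g t)) := fun t =>
    (hright t).mono (inter_subset_left.trans Ioi_subset_Ici_self)
  have hle : ∀ d ∈ D, ∀ t, d < t → g t ≤ g d := fun d hd t hdt => by
    have := hne t
    refine le_of_tendsto (hlim t) ?_
    filter_upwards [self_mem_nhdsWithin] with e he
    exact hg hd he.2 (hdt.trans he.1).le
  intro s t hst
  rcases hst.eq_or_lt with rfl | hst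
  · exact le_rfl
  · have := hne s
    refine ge_of_tendsto (hlim s) ?_
    filter_upwards [self_mem_nhdsWithin, mem_nhdsWithin_of_mem_nhds (Iio_mem_nhds hst)]
      with d hd hdt
    exact hle d hd.2 t hdt

theorem ae_nonpos_of_forall_mgf_le {Ω : Type*} [MeasurableSpace Ω] {P : Measure Ω}
    [IsFiniteMeasure P] {Y : Ω → ℝ} {C : ℝ} (h : ∀ l, 0 < l →
      Integrable (fun ω => Real.exp (l * Y ω)) P ∧ mgf Y P l ≤ C) : ∀ᵐ ω ∂P, Y ω ≤ 0 := by
  have hlt : ∀ n : ℕ, ∀ᵐ ω ∂P, Y ω < 1 / ((n : ℝ) + 1) := by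
    intro n
    set ε : ℝ := 1 / ((n : ℝ) + 1)
    have hε : 0 < ε := by positivity
    have hchernoff : ∀ l : ℝ, 0 < l → P.real {ω | ε ≤ Y ω} ≤ Real.exp (-l * ε) * C :=
      fun l hl => (measure_ge_le_exp_mul_mgf ε hl.le (h l hl).1).trans
        (mul_le_mul_of_nonneg_left (h l hl).2 (Real.exp_pos _).le)
    have hlim : Tendsto (fun l : ℝ => Real.exp (-l * ε) * C) atTop (𝓝 0) := by
      have hbot : Tendsto (fun l : ℝ => -l * ε) atTop atBot :=
        tendsto_neg_atTop_atBot.atBot_mul_const hε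
      simpa using (Real.tendsto_exp_atBot.comp hbot).mul_const C
    have hzero : P.real {ω | ε ≤ Y ω} = 0 :=
      le_antisymm (ge_of_tendsto hlim ((eventually_gt_atTop 0).mono hchernoff)) measureReal_nonneg
    simpa [ae_iff] using (measureReal_eq_zero_iff).1 hzero
  filter_upwards [ae_all_iff.2 hlt] with ω hω
  exact ge_of_tendsto' tendsto_one_div_add_atTop_nhds_zero_nat fun n => (hω n).le

section LevyProcess

variable {Ω : Type*} [MeasurableSpace Ω] {P : Measure Ω} {X : ℝ≥0 → Ω → ℝ} {μ σ : ℝ}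
  {ν : Measure ℝ}

theorem IsLevyProcess.ae_antitone (hX : IsLevyProcess X P) (h : ∀ t, ∀ᵐ ω ∂P, X t ω ≤ 0) :
    ∀ᵐ ω ∂P, Antitone fun t => X t ω := by
  obtain ⟨D, hDc, hD⟩ := TopologicalSpace.exists_countable_dense ℝ≥0
  have hincrement : ∀ d e : ℝ≥0, ∀ᵐ ω ∂P, d ≤ e → X e ω ≤ X d ω := by
    intro d e
    rcases le_or_gt d e with hde | hde
    · have hlaw := (hX.stationary d (e - d)).symm.ae_snd (p := fun y => y ≤ 0) measurableSet_Iic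
        (h (e - d))
      rw [add_tsub_cancel_of_le hde] at hlaw
      exact hlaw.mono fun ω hω _ => sub_nonpos.1 hω
    · exact Eventually.of_forall fun ω hle => absurd hle hde.not_ge
  have hD_antitone : ∀ᵐ ω ∂P, ∀ d ∈ D, ∀ e ∈ D, d ≤ e → X e ω ≤ X d ω :=
    (ae_ball_iff hDc).2 fun d _ => (ae_ball_iff hDc).2 fun e _ => hincrement d e
  filter_upwards [hD_antitone, hX.cadlag] with ω hω hcadlag
  exact antitone_of_antitoneOn_dense (fun d hd e he hde => hω d hd e he hde) hD
    fun t => (hcadlag t).1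

variable [IsProbabilityMeasure P]

namespace IsSpectrallyNegativeLevy

theorem integrable_exp_and_mgf_eq (hX : IsSpectrallyNegativeLevy X P μ σ ν) (t : ℝ≥0)
    {l : ℝ} (hl : 0 ≤ l) :
    Integrable (fun ω => Real.exp (l * X t ω)) P ∧
      mgf (X t) P l = Real.exp (t * levyLaplaceExponent μ σ ν l) := by
  have hm := hX.isLevy.measurable t
  have : IsProbabilityMeasure (P.map (X t)) := Measure.isProbabilityMeasure_map hm.aemeasurable
  obtain ⟨hinteg, heq⟩ := integrable_and_integral_exp_eq_of_charFun
    (hX.triplet.isLevyMeasure.smul t) (by simp [hX.no_pos_jumps]) (m := P.map (X t))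
    (μ := t * μ) (σ := √t * σ) (fun θ => by
      rw [hX.triplet.charFun_eq t θ, levyKhintchineExponent_smul, neg_mul]) hl
  rw [levyLaplaceExponent_smul] at heq
  rw [integrable_map_measure (by fun_prop) hm.aemeasurable] at hinteg
  rw [integral_map hm.aemeasurable (by fun_prop)] at heq
  exact ⟨hinteg, heq⟩

theorem laplaceExponent_eq (hX : IsSpectrallyNegativeLevy X P μ σ ν) {l : ℝ} (hl : 0 ≤ l) :
    laplaceExponent X P l = levyLaplaceExponent μ σ ν l := by
  rw [laplaceExponent, cgf, (hX.integrable_exp_and_mgf_eq 1 hl).2, Real.log_exp, NNReal.coe_one,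
    one_mul]

theorem exists_lt_levyLaplaceExponent (hX : IsSpectrallyNegativeLevy X P μ σ ν) (C : ℝ) :
    ∃ l, 0 < l ∧ C < levyLaplaceExponent μ σ ν l := by
  by_contra! hbounded
  refine hX.not_antitone (hX.isLevy.ae_antitone fun t => ?_)
  refine ae_nonpos_of_forall_mgf_le (C := Real.exp (t * C)) fun l hl => ?_
  obtain ⟨hinteg, hmgf⟩ := hX.integrable_exp_and_mgf_eq t hl.le
  refine ⟨hinteg, hmgf.trans_le ?_⟩
  gcongr
  exact hbounded l hl

end IsSpectrallyNegativeLevy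

end LevyProcess

theorem measure_eq_of_forall_Iio_eq {ν ρ : Measure ℝ} (hν : ∀ᵐ x ∂ν, x < 0) (hρ : ∀ᵐ x ∂ρ, x < 0)
    (hfin : ∀ a < 0, ν (Iio a) ≠ ∞) (h : ∀ a < 0, ν (Iio a) = ρ (Iio a)) : ν = ρ := by
  have hunion : (⋃ n : ℕ, Iio (-(1 / ((n : ℝ) + 1)))) = Iio 0 := by
    ext x
    simp only [mem_iUnion, mem_Iio]
    refine ⟨fun ⟨n, hn⟩ => hn.trans (neg_neg_iff_pos.2 (by positivity)), fun hx => ?_⟩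
    obtain ⟨n, hn⟩ := exists_nat_one_div_lt (neg_pos.2 hx)
    exact ⟨n, by linarith⟩
  rw [← Measure.restrict_eq_self_of_ae_mem (s := Iio 0) hν,
    ← Measure.restrict_eq_self_of_ae_mem (s := Iio 0) hρ, ← hunion,
    Measure.restrict_iUnion_congr]
  intro n
  have hneg : -(1 / ((n : ℝ) + 1)) < 0 := neg_neg_iff_pos.2 (by positivity)
  set a : ℝ := -(1 / ((n : ℝ) + 1))
  have : IsFiniteMeasure (ν.restrict (Iio a)) := ⟨by
    rw [Measure.restrict_apply_univ]
    exact (hfin a hneg).lt_top⟩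
  refine ext_of_generate_finite _ (borel_eq_generateFrom_Iio ℝ ▸ BorelSpace.measurable_eq)
    isPiSystem_Iio ?_ ?_
  · rintro _ ⟨c, rfl⟩
    rw [Measure.restrict_apply measurableSet_Iio, Measure.restrict_apply measurableSet_Iio,
      Iio_inter_Iio]
    exact h _ ((min_le_right c a).trans_lt hneg)
  · rw [Measure.restrict_apply_univ, Measure.restrict_apply_univ, h a hneg]

theorem laplaceKernel_neg {b : ℝ} (hb : b ≠ 0) (x : ℝ) : laplaceKernel b (-x) =
    ((Real.exp (b * x) - 1 - (if |x| < 1 then b * x else 0)) / b -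
      (Real.exp (1 * x) - 1 - (if |x| < 1 then 1 * x else 0))) / (b - 1) := by
  rw [laplaceKernel, mul_neg, neg_neg, neg_neg, one_mul]
  congr 1
  split_ifs <;> field_simp <;> ring

namespace IsLevyMeasure

variable {ν : Measure ℝ}

theorem measure_Iio_ne_top (hν : IsLevyMeasure ν) {a : ℝ} (ha : a < 0) : ν (Iio a) ≠ ∞ := by
  have hfin := (hν.isFiniteMeasure_restrict_Iic (neg_pos.2 ha)).measure_univ_lt_top
  rw [Measure.restrict_apply_univ, neg_neg] at hfin
  exact ne_top_of_le_ne_top hfin.ne (measure_mono Iio_subset_Iic_self)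

theorem eq_map_withDensity (hν : IsLevyMeasure ν) (h0 : ν (Ioi 0) = 0) {f : ℝ → ℝ}
    (htail : ∀ x : ℝ, 0 < x → ν (Iio (-x)) = ∫⁻ y in Ioi x, ENNReal.ofReal (f y)) :
    ν = ((volume.restrict (Ioi 0)).withDensity fun y => ENNReal.ofReal (f y)).map Neg.neg := by
  refine measure_eq_of_forall_Iio_eq (hν.ae_neg h0) ?_ (fun a ha => hν.measure_Iio_ne_top ha)
    fun a ha => ?_
  · rw [ae_map_iff measurable_neg.aemeasurable measurableSet_Iio]
    refine (withDensity_absolutelyContinuous _ _).ae_le ?_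
    filter_upwards [ae_restrict_mem measurableSet_Ioi] with y hy
    simpa using hy
  · have hpreimage : Neg.neg ⁻¹' Iio a ∩ Ioi 0 = Ioi (-a) := by
      ext y
      simp only [mem_inter_iff, mem_preimage, mem_Iio, mem_Ioi]
      exact ⟨fun h => by linarith [h.1], fun h => ⟨by linarith, by linarith⟩⟩
    rw [Measure.map_apply measurable_neg measurableSet_Iio,
      withDensity_apply _ (measurable_neg measurableSet_Iio),
      Measure.restrict_restrict (measurable_neg measurableSet_Iio), hpreimage,
      ← htail _ (neg_pos.2 ha), neg_neg]

theorem integrable_laplaceKernel_neg (hν : IsLevyMeasure ν) (h0 : ν (Ioi 0) = 0) {b : ℝ}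
    (hb : 0 < b) : Integrable (fun x => laplaceKernel b (-x)) ν := by
  simp_rw [laplaceKernel_neg hb.ne']
  exact (((hν.integrable_laplace h0 hb.le).div_const b).sub
    (hν.integrable_laplace h0 zero_le_one)).div_const _

theorem integral_laplaceKernel_neg (hν : IsLevyMeasure ν) (h0 : ν (Ioi 0) = 0) {b : ℝ}
    (hb : 0 < b) : ∫ x, laplaceKernel b (-x) ∂ν =
      ((∫ x, (Real.exp (b * x) - 1 - (if |x| < 1 then b * x else 0)) ∂ν) / b -
        ∫ x, (Real.exp (1 * x) - 1 - (if |x| < 1 then 1 * x else 0)) ∂ν) / (b - 1) := by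
  simp_rw [laplaceKernel_neg hb.ne']
  rw [integral_div, integral_sub ((hν.integrable_laplace h0 hb.le).div_const b)
    (hν.integrable_laplace h0 zero_le_one), integral_div]

theorem lintegral_laplaceKernel_mul_density (hν : IsLevyMeasure ν) (h0 : ν (Ioi 0) = 0)
    {f : ℝ → ℝ} (hf : ContinuousOn f (Ioi 0))
    (htail : ∀ x : ℝ, 0 < x → ν (Iio (-x)) = ∫⁻ y in Ioi x, ENNReal.ofReal (f y)) {b : ℝ}
    (hb : 0 < b) :
    ∫⁻ x in Ioi 0, ENNReal.ofReal (laplaceKernel b x) * ENNReal.ofReal (f x) =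
      ENNReal.ofReal (∫ x, laplaceKernel b (-x) ∂ν) := by
  have hmeas : Measurable fun x => ENNReal.ofReal (laplaceKernel b (-x)) :=
    ((measurable_laplaceKernel b).comp measurable_neg).ennreal_ofReal
  rw [ofReal_integral_eq_lintegral_ofReal (hν.integrable_laplaceKernel_neg h0 hb)
    (Eventually.of_forall fun x => laplaceKernel_nonneg hb _)]
  conv_rhs => rw [hν.eq_map_withDensity h0 htail]
  rw [lintegral_map hmeas measurable_neg, lintegral_withDensity_eq_lintegral_mul₀
    (hf.aemeasurable measurableSet_Ioi).ennreal_ofReal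
    (g := fun x => ENNReal.ofReal (laplaceKernel b (- -x)))
    (hmeas.comp measurable_neg).aemeasurable]
  refine lintegral_congr fun x => ?_
  simp only [Pi.mul_apply, neg_neg, mul_comm]

theorem exists_levyLaplaceExponent_eq (hν : IsLevyMeasure ν) (h0 : ν (Ioi 0) = 0)
    (hcm : HasCompletelyMonotoneTailDensity ν) (μ σ : ℝ) :
    ∃ R, IsStieltjes R ∧ ∀ b, 0 < b → levyLaplaceExponent μ σ ν b =
      b * (levyLaplaceExponent μ σ ν 1 + (b - 1) * R b) := by
  obtain ⟨f, hf, htail⟩ := hcm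
  have hkernel := fun b (hb : 0 < b) =>
    hν.lintegral_laplaceKernel_mul_density h0 hf.continuousOn htail hb
  have hzero : Tendsto f atTop (𝓝 0) := hf.tendsto_zero (by
    rw [← htail 1 one_pos]
    exact hν.measure_Iio_ne_top (by norm_num))
  obtain ⟨R, hR, hR_eq⟩ := hf.exists_isStieltjes hzero fun b hb => by
    rw [hkernel b hb]
    exact ENNReal.ofReal_ne_top
  refine ⟨fun b => σ ^ 2 / 2 + R b, (isStieltjes_const (by positivity)).add hR, fun b hb => ?_⟩
  rcases eq_or_ne b 1 with rfl | hb1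
  · simp only [sub_self, zero_mul, add_zero, one_mul]
  have hRb : R b = ∫ x, laplaceKernel b (-x) ∂ν := by
    rw [hR_eq b hb hb1, hkernel b hb, ENNReal.toReal_ofReal
      (integral_nonneg fun x => laplaceKernel_nonneg hb _)]
  have hb1' : b - 1 ≠ 0 := sub_ne_zero.2 hb1
  beta_reduce
  rw [hRb, hν.integral_laplaceKernel_neg h0 hb, levyLaplaceExponent, levyLaplaceExponent]
  field_simp
  ring

end IsLevyMeasure

/-! ### The reciprocal of the shifted exponent -/

theorem exists_measure_integral_eq_cauchyKernel_mul (κ : Measure unitInterval) [IsFiniteMeasure κ]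
    {c : ℝ} (hc : 0 < c) :
    ∃ m : Measure unitInterval, IsFiniteMeasure m ∧
      ∀ h : unitInterval → ℝ, ∫ u, h u ∂m = ∫ u, cauchyKernel c u * h u ∂κ := by
  refine ⟨κ.withDensity fun u => ENNReal.ofReal (cauchyKernel c u),
    isFiniteMeasure_withDensity_ofReal (integrable_cauchyKernel hc κ).2, fun h => ?_⟩
  rw [integral_withDensity_eq_integral_toReal_smul
    (continuous_cauchyKernel hc).measurable.ennreal_ofReal
    (Eventually.of_forall fun u => ENNReal.ofReal_lt_top)]
  simp_rw [ENNReal.toReal_ofReal (cauchyKernel_pos hc _).le, smul_eq_mul]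

theorem sub_one_mul_cauchyKernel_sub {b c : ℝ} (hb : 0 < b) (hc : 0 < c) (u : unitInterval) :
    (b - 1) * cauchyKernel b u - (c - 1) * cauchyKernel c u =
      (b - c) * (cauchyKernel c u * cauchyKernel b u) := by
  have hb' := (cauchyKernel_denom_pos hb u).ne'
  have hc' := (cauchyKernel_denom_pos hc u).ne'
  rw [cauchyKernel, cauchyKernel, ← mul_inv, ← div_eq_mul_inv, ← div_eq_mul_inv,
    ← div_eq_mul_inv, div_sub_div _ _ hb' hc', mul_comm (1 + (b - 1) * (u : ℝ))]
  ring

theorem cauchyKernel_sub_cauchyKernel {b c : ℝ} (hb : 0 < b) (hc : 0 < c) (u : unitInterval) :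
    cauchyKernel c u - cauchyKernel b u =
      (b - c) * (cauchyKernel c u * (u * cauchyKernel b u)) := by
  have hb' := (cauchyKernel_denom_pos hb u).ne'
  have hc' := (cauchyKernel_denom_pos hc u).ne'
  rw [cauchyKernel, cauchyKernel, inv_sub_inv hc' hb', div_eq_mul_inv, mul_inv]
  ring

theorem coe_mul_cauchyKernel {u : unitInterval} (hu : 0 < u) (b : ℝ) :
    u * cauchyKernel b u = (b + ((u : ℝ)⁻¹ - 1))⁻¹ := by
  have hu' : (u : ℝ) ≠ 0 := (show (0 : ℝ) < u from hu).ne'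
  have hfactor : 1 + (b - 1) * u = u * (b + ((u : ℝ)⁻¹ - 1)) := by
    field_simp
    ring
  rw [cauchyKernel, hfactor, mul_inv, mul_inv_cancel_left₀ hu']

theorem exists_measure_integral_inv_add_eq (m : Measure unitInterval) [IsFiniteMeasure m] :
    ∃ τ : Measure ℝ, IsFiniteMeasure τ ∧ (∀ᵐ s ∂τ, 0 ≤ s) ∧
      ∀ b, ∫ s, (b + s)⁻¹ ∂τ = ∫ u : unitInterval, u * cauchyKernel b u ∂m := by
  have hmeas : Measurable fun u : unitInterval => (u : ℝ)⁻¹ - 1 := by fun_prop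
  have hset : MeasurableSet (Ioi (0 : unitInterval)) := measurableSet_Ioi
  refine ⟨(m.restrict (Ioi 0)).map fun u : unitInterval => (u : ℝ)⁻¹ - 1, inferInstance, ?_,
    fun b => ?_⟩
  · rw [ae_map_iff hmeas.aemeasurable measurableSet_Ici]
    filter_upwards [ae_restrict_mem hset] with u hu
    exact sub_nonneg.2 (one_le_inv_iff₀.2 ⟨hu, u.2.2⟩)
  · rw [integral_map hmeas.aemeasurable (Measurable.aestronglyMeasurable (by fun_prop)),
      setIntegral_congr_fun hset fun u hu => (coe_mul_cauchyKernel hu b).symm]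
    refine setIntegral_eq_integral_of_forall_compl_eq_zero fun u hu => ?_
    have hu0 : u = 0 := le_antisymm (not_lt.1 hu) u.2.1
    rw [hu0, Set.Icc.coe_zero, zero_mul]

namespace IsStieltjes

theorem exists_sub_one_mul_sub_eq {R : ℝ → ℝ} (hR : IsStieltjes R) {c : ℝ} (hc : 0 < c) :
    ∃ S, IsStieltjes S ∧ ∀ b, 0 < b → (b - 1) * R b - (c - 1) * R c = (b - c) * S b := by
  obtain ⟨κ, hκ, hR⟩ := hR
  obtain ⟨m, hm, hm_integral⟩ := exists_measure_integral_eq_cauchyKernel_mul κ hc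
  refine ⟨fun b => ∫ u, cauchyKernel b u ∂m, ⟨m, hm, fun b _ => rfl⟩, fun b hb => ?_⟩
  beta_reduce
  rw [hm_integral, hR b hb, hR c hc, ← integral_const_mul, ← integral_const_mul,
    ← integral_const_mul, ← integral_sub ((integrable_cauchyKernel hb κ).const_mul _)
      ((integrable_cauchyKernel hc κ).const_mul _)]
  exact integral_congr_ae (Eventually.of_forall (sub_one_mul_cauchyKernel_sub hb hc))

theorem exists_div_sub_eq {T : ℝ → ℝ} (hT : IsStieltjes T) {c : ℝ} (hc : 0 < c) :
    ∃ m : Measure ℝ, IsFiniteMeasure m ∧ (∀ᵐ s ∂m, 0 ≤ s) ∧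
      ∀ b, c < b → T b / (b - c) = T c / (b - c) - ∫ s, (b + s)⁻¹ ∂m := by
  obtain ⟨κ, hκ, hT⟩ := hT
  obtain ⟨m, hm, hm_integral⟩ := exists_measure_integral_eq_cauchyKernel_mul κ hc
  obtain ⟨τ, hτ, hτ0, hτ_integral⟩ := exists_measure_integral_inv_add_eq m
  refine ⟨τ, hτ, hτ0, fun b hcb => ?_⟩
  have hb : 0 < b := hc.trans hcb
  have hbc : b - c ≠ 0 := (sub_pos.2 hcb).ne'
  have hdiff : T c - T b = (b - c) * ∫ s, (b + s)⁻¹ ∂τ := by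
    rw [hτ_integral, hm_integral, hT b hb, hT c hc, ← integral_const_mul,
      ← integral_sub (integrable_cauchyKernel hc κ) (integrable_cauchyKernel hb κ)]
    exact integral_congr_ae (Eventually.of_forall (cauchyKernel_sub_cauchyKernel hb hc))
  rw [eq_sub_iff_add_eq, ← eq_sub_iff_add_eq', ← sub_div, hdiff, mul_div_cancel_left₀ _ hbc]

end IsStieltjes

theorem exists_pos_root_of_largestRoot_pos {ψ : ℝ → ℝ} {q : ℝ} (h : 0 < largestRoot ψ q) :
    ∃ Φ, 0 < Φ ∧ ψ Φ = q := by
  by_contra! hcon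
  exact h.not_ge (Real.sSup_nonpos fun l hl => not_lt.1 fun hl0 => hcon l hl0 hl.2)

section Factorization

variable {ψ R : ℝ → ℝ} {p q Φ : ℝ} (hR : IsStieltjes R)
  (hψ : ∀ b, 0 < b → ψ b = b * (p + (b - 1) * R b))
include hR hψ

theorem exists_pos_root (hq : 0 < q) {b : ℝ} (hb : 0 < b) (hqb : q < ψ b) :
    ∃ Φ, 0 < Φ ∧ ψ Φ = q := by
  have hsmall : ∀ᶠ ε in 𝓝[>] (0 : ℝ), ε * p < q := by
    have hlim : Tendsto (fun ε => ε * p) (𝓝 0) (𝓝 0) :=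
      Continuous.tendsto' (by fun_prop) _ _ (zero_mul p)
    exact (hlim.mono_left nhdsWithin_le_nhds).eventually_lt_const hq
  obtain ⟨ε, hεq, hε, hε_lt⟩ := (hsmall.and (Ioo_mem_nhdsGT (lt_min one_pos hb))).exists
  have hψε : ψ ε ≤ q := by
    have hR_nonpos : (ε - 1) * R ε ≤ 0 :=
      mul_nonpos_of_nonpos_of_nonneg (sub_nonpos.2 (hε_lt.le.trans (min_le_left _ _)))
        (hR.nonneg hε)
    rw [hψ ε hε]
    exact (mul_le_mul_of_nonneg_left (by linarith) hε.le).trans hεq.le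
  have hcont : ContinuousOn ψ (Ioi 0) := by
    have := hR.continuousOn
    exact ContinuousOn.congr (by fun_prop) hψ
  obtain ⟨Φ, hΦ, hΦq⟩ := intermediate_value_Icc (hε_lt.le.trans (min_le_right _ _))
    (hcont.mono fun l hl => hε.trans_le hl.1) ⟨hψε, hqb.le⟩
  exact ⟨Φ, hε.trans_le hΦ.1, hΦq⟩

theorem exists_isStieltjes_sub_eq (hq : 0 ≤ q) (hΦ : 0 < Φ) (hΦq : ψ Φ = q) :
    ∃ S, IsStieltjes S ∧ ∀ b, 0 < b → ψ b - q = (b - Φ) * (b * S b) := by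
  obtain ⟨S, hS, hS_eq⟩ := hR.exists_sub_one_mul_sub_eq hΦ
  refine ⟨fun b => S b + q / Φ * (0 + b)⁻¹,
    hS.add ((isStieltjes_inv_add le_rfl).const_mul (div_nonneg hq hΦ.le)), fun b hb => ?_⟩
  have hp : p = q / Φ - (Φ - 1) * R Φ := by
    rw [eq_sub_iff_add_eq, eq_div_iff hΦ.ne', mul_comm, ← hψ Φ hΦ, hΦq]
  have hsum : p + (b - 1) * R b = q / Φ + (b - Φ) * S b := by
    rw [hp, ← hS_eq b hb]
    ring
  beta_reduce
  rw [hψ b hb, hsum, zero_add]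
  field_simp
  ring

theorem exists_isStieltjes_pos_sub_eq (hq : 0 ≤ q) (hΦ : 0 < Φ) (hΦq : ψ Φ = q)
    (hne : ∃ b, 0 < b ∧ ψ b ≠ q) :
    ∃ S, IsStieltjes S ∧ (∀ b, 0 < b → 0 < S b) ∧
      ∀ b, 0 < b → ψ b - q = (b - Φ) * (b * S b) := by
  obtain ⟨S, hS, hfactor⟩ := exists_isStieltjes_sub_eq hR hψ hq hΦ hΦq
  obtain ⟨b₀, hb₀, hne⟩ := hne
  refine ⟨S, hS, fun b hb => hS.pos_of_ne_zero hb₀ (fun h => hne (sub_eq_zero.1 ?_)) hb, hfactor⟩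
  rw [hfactor b₀ hb₀, h, mul_zero, mul_zero]

theorem largestRoot_eq (hq : 0 ≤ q) (hΦ : 0 < Φ) (hΦq : ψ Φ = q) (hne : ∃ b, 0 < b ∧ ψ b ≠ q) :
    largestRoot ψ q = Φ := by
  obtain ⟨S, -, hpos, hfactor⟩ := exists_isStieltjes_pos_sub_eq hR hψ hq hΦ hΦq hne
  refine IsGreatest.csSup_eq ⟨⟨hΦ.le, hΦq⟩, fun l ⟨hl, hlq⟩ => ?_⟩
  rcases hl.eq_or_lt with rfl | hl
  · exact hΦ.le
  have hzero := hfactor l hl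
  rw [hlq, sub_self, zero_eq_mul] at hzero
  exact (sub_eq_zero.1 (hzero.resolve_right (mul_pos hl (hpos l hl)).ne')).le

theorem exists_inv_sub_eq (hq : 0 ≤ q) (hΦ : 0 < Φ) (hΦq : ψ Φ = q)
    (hne : ∃ b, 0 < b ∧ ψ b ≠ q) :
    ∃ A : ℝ, 0 < A ∧ ∃ m : Measure ℝ, IsFiniteMeasure m ∧ (∀ᵐ s ∂m, 0 ≤ s) ∧
      ∀ b, Φ < b → 1 / (ψ b - q) = A / (b - Φ) - ∫ s, (b + s)⁻¹ ∂m := by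
  obtain ⟨S, hS, hpos, hfactor⟩ := exists_isStieltjes_pos_sub_eq hR hψ hq hΦ hΦq hne
  obtain ⟨m, hm, hm0, hm_eq⟩ := (hS.inv_mul (hpos 1 one_pos).ne').exists_div_sub_eq hΦ
  refine ⟨(Φ * S Φ)⁻¹, inv_pos.2 (mul_pos hΦ (hpos Φ hΦ)), m, hm, hm0, fun b hb => ?_⟩
  rw [← hm_eq b hb, hfactor b (hΦ.trans hb), one_div, mul_inv, div_eq_mul_inv, mul_comm]

end Factorization

/-! ### Uniqueness of Laplace transforms -/

theorem eqOn_complexMGF_of_eventuallyEq_mgf {m m' : Measure ℝ} {t : ℝ}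
    (hm : t ∈ interior (integrableExpSet id m)) (hm' : t ∈ interior (integrableExpSet id m'))
    (h : mgf id m =ᶠ[𝓝 t] mgf id m') :
    EqOn (complexMGF id m) (complexMGF id m')
      {z | z.re ∈ interior (integrableExpSet id m) ∩ interior (integrableExpSet id m')} := by
  have hstrip : IsPreconnected
      {z : ℂ | z.re ∈ interior (integrableExpSet id m) ∩ interior (integrableExpSet id m')} :=
    ((convex_integrableExpSet.interior.inter
      convex_integrableExpSet.interior).linear_preimage Complex.reLm).isPreconnected
  refine (analyticOnNhd_complexMGF.mono fun z hz => hz.1).eqOn_of_preconnected_of_frequently_eq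
    (analyticOnNhd_complexMGF.mono fun z hz => hz.2) hstrip (z₀ := (t : ℂ)) ⟨hm, hm'⟩ ?_
  have hofReal : Tendsto (fun s : ℝ => (s : ℂ)) (𝓝[≠] t) (𝓝[≠] (t : ℂ)) :=
    tendsto_nhdsWithin_of_tendsto_nhds_of_eventually_within _
      (Complex.continuous_ofReal.tendsto t |>.mono_left nhdsWithin_le_nhds)
      (eventually_mem_nhdsWithin.mono fun s hs => Complex.ofReal_injective.ne hs)
  refine hofReal.frequently (Eventually.frequently ?_)
  filter_upwards [h.filter_mono nhdsWithin_le_nhds] with s hs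
  rw [complexMGF_ofReal, complexMGF_ofReal, hs]

theorem measure_eq_of_eventuallyEq_mgf {m m' : Measure ℝ} [IsFiniteMeasure m] [IsFiniteMeasure m']
    (hm : 0 ∈ interior (integrableExpSet id m)) (hm' : 0 ∈ interior (integrableExpSet id m'))
    (h : mgf id m =ᶠ[𝓝 0] mgf id m') : m = m' := by
  refine Measure.ext_of_charFun (funext fun θ => ?_)
  rw [← complexMGF_id_mul_I, ← complexMGF_id_mul_I]
  exact eqOn_complexMGF_of_eventuallyEq_mgf hm hm' h (by simpa using ⟨hm, hm'⟩)

section LaplaceUniqueness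

variable {w : ℝ → ℝ} {b t : ℝ} (hw : ∀ x, 0 < x → 0 ≤ w x)
  (hb : IntegrableOn (fun x => Real.exp (-b * x) * w x) (Ioi 0))
include hw hb

theorem integrable_exp_withDensity_iff :
    Integrable (fun x => Real.exp (t * x))
        ((volume.restrict (Ioi 0)).withDensity fun x => ENNReal.ofReal (Real.exp (-b * x) * w x)) ↔
      IntegrableOn (fun x => Real.exp (-(b - t) * x) * w x) (Ioi 0) := by
  rw [integrable_withDensity_iff_integrable_smul₀' hb.aemeasurable.ennreal_ofReal
    (Eventually.of_forall fun x => ENNReal.ofReal_lt_top)]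
  refine integrableOn_congr_fun (fun x hx => ?_) measurableSet_Ioi
  rw [ENNReal.toReal_ofReal (mul_nonneg (Real.exp_pos _).le (hw x hx)), smul_eq_mul,
    mul_right_comm, ← Real.exp_add]
  ring_nf

theorem mgf_id_withDensity :
    mgf id ((volume.restrict (Ioi 0)).withDensity
        fun x => ENNReal.ofReal (Real.exp (-b * x) * w x)) t =
      ∫ x in Ioi 0, Real.exp (-(b - t) * x) * w x := by
  rw [mgf, integral_withDensity_eq_integral_toReal_smul₀ hb.aemeasurable.ennreal_ofReal
    (Eventually.of_forall fun x => ENNReal.ofReal_lt_top)]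
  refine setIntegral_congr_fun measurableSet_Ioi fun x hx => ?_
  rw [ENNReal.toReal_ofReal (mul_nonneg (Real.exp_pos _).le (hw x hx)), smul_eq_mul,
    mul_right_comm, ← Real.exp_add, id_eq]
  ring_nf

omit hb in
theorem zero_mem_interior_integrableExpSet_withDensity {c : ℝ} (hcb : c < b)
    (hi : ∀ b, c < b → IntegrableOn (fun x => Real.exp (-b * x) * w x) (Ioi 0)) :
    0 ∈ interior (integrableExpSet id ((volume.restrict (Ioi 0)).withDensity
      fun x => ENNReal.ofReal (Real.exp (-b * x) * w x))) :=
  mem_interior.2 ⟨Iio (b - c), fun _ ht => (integrable_exp_withDensity_iff hw (hi b hcb)).2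
    (hi _ (lt_sub_comm.1 ht)), isOpen_Iio, sub_pos.2 hcb⟩

end LaplaceUniqueness

theorem ae_eq_of_laplace_eq {w w' : ℝ → ℝ} {c : ℝ} (hw : ∀ x, 0 < x → 0 ≤ w x)
    (hw' : ∀ x, 0 < x → 0 ≤ w' x)
    (hi : ∀ b, c < b → IntegrableOn (fun x => Real.exp (-b * x) * w x) (Ioi 0))
    (hi' : ∀ b, c < b → IntegrableOn (fun x => Real.exp (-b * x) * w' x) (Ioi 0))
    (h : ∀ b, c < b → ∫ x in Ioi (0 : ℝ), Real.exp (-b * x) * w x =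
      ∫ x in Ioi (0 : ℝ), Real.exp (-b * x) * w' x) :
    w =ᵐ[volume.restrict (Ioi 0)] w' := by
  obtain ⟨b, hcb⟩ := exists_gt c
  have := isFiniteMeasure_withDensity_ofReal (hi b hcb).2
  have := isFiniteMeasure_withDensity_ofReal (hi' b hcb).2
  have hmeasure := measure_eq_of_eventuallyEq_mgf
    (zero_mem_interior_integrableExpSet_withDensity hw hcb hi)
    (zero_mem_interior_integrableExpSet_withDensity hw' hcb hi') (by
      filter_upwards [Iio_mem_nhds (sub_pos.2 hcb)] with t ht
      rw [mgf_id_withDensity hw (hi b hcb), mgf_id_withDensity hw' (hi' b hcb),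
        h _ (lt_sub_comm.1 ht)])
  have hdensity := (withDensity_eq_iff (hi b hcb).aemeasurable.ennreal_ofReal
    (hi' b hcb).aemeasurable.ennreal_ofReal (hi b hcb).lintegral_lt_top.ne).1 hmeasure
  filter_upwards [hdensity, ae_restrict_mem measurableSet_Ioi] with x hx hx0
  have hexp := Real.exp_pos (-b * x)
  rw [ENNReal.ofReal_eq_ofReal_iff (mul_nonneg hexp.le (hw x hx0))
    (mul_nonneg hexp.le (hw' x hx0))] at hx
  exact mul_left_cancel₀ hexp.ne' hx

theorem eqOn_Ioi_of_ae_eq {w w' : ℝ → ℝ} {c : ℝ} (h : w =ᵐ[volume.restrict (Ioi c)] w')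
    (hw : ∀ x, c < x → ContinuousWithinAt w (Ici x) x)
    (hw' : ∀ x, c < x → ContinuousWithinAt w' (Ici x) x) : EqOn w w' (Ioi c) := by
  intro x hx
  have hdense : Dense {y | c < y → w y = w' y} :=
    Measure.dense_of_ae ((ae_restrict_iff' measurableSet_Ioi).1 h)
  have hx_closure : x ∈ closure (Ioi x ∩ {y | c < y → w y = w' y}) := by
    refine closure_minimal (hdense.open_subset_closure_inter isOpen_Ioi) isClosed_closure ?_
    rw [closure_Ioi]
    exact self_mem_Ici
  have := mem_closure_iff_nhdsWithin_neBot.1 hx_closure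
  have hsubset : Ioi x ∩ {y | c < y → w y = w' y} ⊆ Ici x :=
    inter_subset_left.trans Ioi_subset_Ici_self
  refine tendsto_nhds_unique_of_eventuallyEq ((hw x hx).mono hsubset) ((hw' x hx).mono hsubset) ?_
  filter_upwards [self_mem_nhdsWithin] with y hy using hy.2 (hx.trans hy.1)

/-! ### The scale function -/

section LaplaceTransform

variable {m : Measure ℝ} [IsFiniteMeasure m] (hm : ∀ᵐ s ∂m, 0 ≤ s)
include hm

theorem integrable_exp_mul_neg {x : ℝ} (hx : 0 ≤ x) :
    Integrable (fun s => Real.exp (x * -s)) m := by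
  refine Integrable.of_bound (C := 1) (by fun_prop) (hm.mono fun s hs => ?_)
  rw [Real.norm_of_nonneg (Real.exp_pos _).le, Real.exp_le_one_iff, mul_neg, neg_nonpos]
  positivity

theorem mem_interior_integrableExpSet_neg {x : ℝ} (hx : 0 < x) :
    x ∈ interior (integrableExpSet (fun s => -s) m) :=
  mem_interior.2 ⟨Ioi 0, fun _ hy => integrable_exp_mul_neg hm (le_of_lt hy), isOpen_Ioi, hx⟩

theorem hasDerivAt_iteratedDeriv_mgf_neg (n : ℕ) {x : ℝ} (hx : 0 < x) :
    HasDerivAt (iteratedDeriv n (mgf (fun s => -s) m))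
      (iteratedDeriv (n + 1) (mgf (fun s => -s) m) x) x := by
  have hx' := mem_interior_integrableExpSet_neg hm hx
  rw [iteratedDeriv_mgf hx']
  exact hasDerivAt_iteratedDeriv_mgf hx' n

theorem iteratedDeriv_three_mgf_neg_nonpos {x : ℝ} (hx : 0 < x) :
    iteratedDeriv 3 (mgf (fun s => -s) m) x ≤ 0 := by
  rw [iteratedDeriv_mgf (mem_interior_integrableExpSet_neg hm hx)]
  refine integral_nonpos_of_ae (hm.mono fun s hs => ?_)
  exact mul_nonpos_of_nonpos_of_nonneg (Odd.pow_nonpos (by decide) (neg_nonpos.2 hs))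
    (Real.exp_pos _).le

theorem antitoneOn_iteratedDeriv_two_mgf_neg :
    AntitoneOn (iteratedDeriv 2 (mgf (fun s => -s) m)) (Ioi 0) := by
  have hderiv := fun x (hx : 0 < x) => hasDerivAt_iteratedDeriv_mgf_neg hm 2 hx
  refine antitoneOn_of_deriv_nonpos (convex_Ioi 0)
    (fun x hx => (hderiv x hx).continuousAt.continuousWithinAt) ?_ ?_ <;> rw [interior_Ioi]
  · exact fun x hx => (hderiv x hx).differentiableAt.differentiableWithinAt
  · intro x hx
    rw [(hderiv x hx).deriv]
    exact iteratedDeriv_three_mgf_neg_nonpos hm hx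

theorem continuousOn_mgf_neg : ContinuousOn (mgf (fun s => -s) m) (Ioi 0) :=
  continuousOn_mgf.mono fun _ hx => mem_interior_integrableExpSet_neg hm hx

theorem integrable_inv_add {b : ℝ} (hb : 0 < b) : Integrable (fun s => (b + s)⁻¹) m := by
  refine Integrable.of_bound (C := b⁻¹) (Measurable.aestronglyMeasurable (by fun_prop))
    (hm.mono fun s hs => ?_)
  rw [Real.norm_of_nonneg (by positivity)]
  exact inv_anti₀ hb (by linarith)

theorem lintegral_exp_mul_mgf_neg {b : ℝ} (hb : 0 < b) :
    ∫⁻ x in Ioi (0 : ℝ), ENNReal.ofReal (Real.exp (-b * x) * mgf (fun s => -s) m x) =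
      ENNReal.ofReal (∫ s, (b + s)⁻¹ ∂m) := by
  have hmgf : ∀ x, 0 < x → ENNReal.ofReal (Real.exp (-b * x) * mgf (fun s => -s) m x) =
      ∫⁻ s, ENNReal.ofReal (Real.exp (-(b + s) * x)) ∂m := fun x hx => by
    rw [mgf, ← integral_const_mul, ofReal_integral_eq_lintegral_ofReal
      ((integrable_exp_mul_neg hm hx.le).const_mul _) (Eventually.of_forall fun s => by positivity)]
    refine lintegral_congr fun s => ?_
    rw [← Real.exp_add]
    ring_nf
  have hexp : ∀ s, 0 ≤ s →
      ∫⁻ x in Ioi (0 : ℝ), ENNReal.ofReal (Real.exp (-(b + s) * x)) =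
        ENNReal.ofReal (b + s)⁻¹ := fun s hs => by
    have hneg : -(b + s) < 0 := by linarith
    rw [← ofReal_integral_eq_lintegral_ofReal (integrableOn_exp_mul_Ioi hneg 0)
      (Eventually.of_forall fun x => (Real.exp_pos _).le), integral_exp_mul_Ioi hneg 0,
      mul_zero, Real.exp_zero, neg_div_neg_eq, one_div]
  rw [setLIntegral_congr_fun measurableSet_Ioi hmgf, lintegral_lintegral_swap (by fun_prop),
    ofReal_integral_eq_lintegral_ofReal (integrable_inv_add hm hb)
      (hm.mono fun s hs => inv_nonneg.2 (by positivity))]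
  exact lintegral_congr_ae (hm.mono hexp)

theorem integrableOn_exp_mul_mgf_neg {b : ℝ} (hb : 0 < b) :
    IntegrableOn (fun x => Real.exp (-b * x) * mgf (fun s => -s) m x) (Ioi 0) := by
  refine ⟨(ContinuousOn.mul (by fun_prop) (continuousOn_mgf_neg hm)).aestronglyMeasurable
    measurableSet_Ioi, ?_⟩
  rw [hasFiniteIntegral_iff_ofReal
    (Eventually.of_forall fun x => mul_nonneg (Real.exp_pos _).le mgf_nonneg),
    lintegral_exp_mul_mgf_neg hm hb]
  exact ENNReal.ofReal_lt_top

theorem integral_exp_mul_mgf_neg {b : ℝ} (hb : 0 < b) :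
    ∫ x in Ioi (0 : ℝ), Real.exp (-b * x) * mgf (fun s => -s) m x = ∫ s, (b + s)⁻¹ ∂m := by
  rw [integral_eq_lintegral_of_nonneg_ae
    (Eventually.of_forall fun x => mul_nonneg (Real.exp_pos _).le mgf_nonneg)
    (integrableOn_exp_mul_mgf_neg hm hb).aestronglyMeasurable, lintegral_exp_mul_mgf_neg hm hb,
    ENNReal.toReal_ofReal (integral_nonneg_of_ae (hm.mono fun s hs => ?_))]
  exact inv_nonneg.2 (by positivity)

end LaplaceTransform

theorem exp_neg_mul_mul_const_mul_exp (A b c x : ℝ) :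
    Real.exp (-b * x) * (A * Real.exp (c * x)) = A * Real.exp (-(b - c) * x) := by
  rw [mul_left_comm, ← Real.exp_add]
  ring_nf

theorem integrableOn_exp_neg_mul_mul_exp (A : ℝ) {b c : ℝ} (hcb : c < b) :
    IntegrableOn (fun x => Real.exp (-b * x) * (A * Real.exp (c * x))) (Ioi 0) := by
  simp_rw [exp_neg_mul_mul_const_mul_exp]
  exact (integrableOn_exp_mul_Ioi (neg_lt_zero.2 (sub_pos.2 hcb)) 0).const_mul A

theorem integral_exp_neg_mul_mul_exp (A : ℝ) {b c : ℝ} (hcb : c < b) :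
    ∫ x in Ioi 0, Real.exp (-b * x) * (A * Real.exp (c * x)) = A / (b - c) := by
  simp_rw [exp_neg_mul_mul_const_mul_exp]
  rw [integral_const_mul, integral_exp_mul_Ioi (neg_lt_zero.2 (sub_pos.2 hcb)), mul_zero,
    Real.exp_zero, neg_div_neg_eq, mul_one_div]

theorem largestRoot_nonneg (ψ : ℝ → ℝ) (q : ℝ) : 0 ≤ largestRoot ψ q :=
  Real.sSup_nonneg fun _ hl => hl.1

theorem IsScaleFunction.eqOn_Ioi {ψ W : ℝ → ℝ} {q A : ℝ} {m : Measure ℝ} [IsFiniteMeasure m]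
    (hW : IsScaleFunction ψ q W) (hA : 0 ≤ A) (hm : ∀ᵐ s ∂m, 0 ≤ s)
    (hψ : ∀ b, largestRoot ψ q < b →
      1 / (ψ b - q) = A / (b - largestRoot ψ q) - ∫ s, (b + s)⁻¹ ∂m) :
    EqOn W (fun x => A * Real.exp (largestRoot ψ q * x) - mgf (fun s => -s) m x) (Ioi 0) := by
  have hpos := fun b (hb : largestRoot ψ q < b) => (largestRoot_nonneg ψ q).trans_lt hb
  have hintegrable : ∀ b, largestRoot ψ q < b →
      IntegrableOn (fun x => Real.exp (-b * x) * (W x + mgf (fun s => -s) m x)) (Ioi 0) :=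
    fun b hb => by
      simp_rw [mul_add]
      exact (hW.integrable b hb).add (integrableOn_exp_mul_mgf_neg hm (hpos b hb))
  have hlaplace : ∀ b, largestRoot ψ q < b →
      ∫ x in Ioi (0 : ℝ), Real.exp (-b * x) * (W x + mgf (fun s => -s) m x) =
        ∫ x in Ioi (0 : ℝ), Real.exp (-b * x) * (A * Real.exp (largestRoot ψ q * x)) :=
    fun b hb => by
      simp_rw [mul_add]
      rw [integral_add (hW.integrable b hb) (integrableOn_exp_mul_mgf_neg hm (hpos b hb)),
        hW.laplace b hb, hψ b hb, integral_exp_mul_mgf_neg hm (hpos b hb),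
        integral_exp_neg_mul_mul_exp A hb, sub_add_cancel]
  have hae := ae_eq_of_laplace_eq (fun x _ => add_nonneg (hW.nonneg x) mgf_nonneg)
    (fun x _ => by positivity) hintegrable
    (fun b hb => integrableOn_exp_neg_mul_mul_exp A hb) hlaplace
  have heq := eqOn_Ioi_of_ae_eq hae
    (fun x hx => (hW.rightCont x hx.le).add
      ((continuousOn_mgf_neg hm).continuousAt (Ioi_mem_nhds hx)).continuousWithinAt)
    (fun x _ => Continuous.continuousWithinAt (by fun_prop))
  exact fun x hx => eq_sub_of_add_eq (heq hx)

/-! ### Convexity of the scale function -/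

theorem exists_strictConcaveOn_strictConvexOn {f : ℝ → ℝ} {c : ℝ} (hf : ContinuousOn f (Ioi c))
    (hmono : StrictMonoOn (deriv^[2] f) (Ioi c)) (hnonneg : ∃ x, c < x ∧ 0 ≤ deriv^[2] f x) :
    ∃ a, c ≤ a ∧ StrictConcaveOn ℝ (Ioo c a) f ∧ StrictConvexOn ℝ (Ioi a) f := by
  set N : Set ℝ := {x | c < x ∧ 0 ≤ deriv^[2] f x}
  have hbdd : BddBelow N := ⟨c, fun x hx => hx.1.le⟩
  have hca : c ≤ sInf N := le_csInf hnonneg fun x hx => hx.1.le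
  refine ⟨sInf N, hca, ?_, ?_⟩
  · refine strictConcaveOn_of_deriv2_neg (convex_Ioo _ _) (hf.mono Ioo_subset_Ioi_self)
      fun x hx => ?_
    rw [interior_Ioo] at hx
    exact not_le.1 fun hx0 => (csInf_le hbdd ⟨hx.1, hx0⟩).not_gt hx.2
  · refine strictConvexOn_of_deriv2_pos (convex_Ioi _) (hf.mono (Ioi_subset_Ioi hca))
      fun x hx => ?_
    rw [interior_Ioi] at hx
    obtain ⟨y, hy, hyx⟩ := exists_lt_of_csInf_lt hnonneg hx
    exact hy.2.trans_lt (hmono hy.1 (hy.1.trans hyx) hyx)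

/-- The `n`-th derivative on `(0, ∞)` of `x ↦ A e^{Φ x} - ∫ e^{-s x} m(ds)`; the case `n = 0` is
the form taken by the scale function. -/
noncomputable def expSubLaplaceDeriv (A Φ : ℝ) (m : Measure ℝ) (n : ℕ) (x : ℝ) : ℝ :=
  A * Φ ^ n * Real.exp (Φ * x) - iteratedDeriv n (mgf (fun s => -s) m) x

section ExpSubLaplace

variable {A Φ : ℝ} {m : Measure ℝ} [IsFiniteMeasure m] (hm : ∀ᵐ s ∂m, 0 ≤ s)
include hm

theorem hasDerivAt_expSubLaplaceDeriv (n : ℕ) {x : ℝ} (hx : 0 < x) :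
    HasDerivAt (expSubLaplaceDeriv A Φ m n) (expSubLaplaceDeriv A Φ m (n + 1) x) x := by
  have hexp : HasDerivAt (fun x => A * Φ ^ n * Real.exp (Φ * x))
      (A * Φ ^ (n + 1) * Real.exp (Φ * x)) x := by
    have h : HasDerivAt (fun x => Real.exp (Φ * x)) (Real.exp (Φ * x) * (Φ * 1)) x :=
      ((hasDerivAt_id x).const_mul Φ).exp
    rw [show A * Φ ^ (n + 1) * Real.exp (Φ * x) = A * Φ ^ n * (Real.exp (Φ * x) * (Φ * 1)) by ring]
    exact h.const_mul (A * Φ ^ n)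
  exact hexp.sub (hasDerivAt_iteratedDeriv_mgf_neg hm n hx)

theorem strictMonoOn_expSubLaplaceDeriv_two (hA : 0 < A) (hΦ : 0 < Φ) :
    StrictMonoOn (expSubLaplaceDeriv A Φ m 2) (Ioi 0) := by
  have hderiv := fun x (hx : 0 < x) => hasDerivAt_expSubLaplaceDeriv (A := A) (Φ := Φ) hm 2 hx
  refine strictMonoOn_of_deriv_pos (convex_Ioi 0)
    (fun x hx => (hderiv x hx).continuousAt.continuousWithinAt) fun x hx => ?_
  rw [interior_Ioi] at hx
  rw [(hderiv x hx).deriv]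
  exact sub_pos.2 ((iteratedDeriv_three_mgf_neg_nonpos hm hx).trans_lt (by positivity))

theorem exists_expSubLaplaceDeriv_two_nonneg (hA : 0 < A) (hΦ : 0 < Φ) :
    ∃ x, 0 < x ∧ 0 ≤ expSubLaplaceDeriv A Φ m 2 x := by
  have hlim : Tendsto (fun x => A * Φ ^ 2 * Real.exp (Φ * x)) atTop atTop :=
    (Real.tendsto_exp_atTop.comp (tendsto_id.const_mul_atTop hΦ)).const_mul_atTop (by positivity)
  obtain ⟨x, hx, hx1⟩ := ((hlim.eventually_ge_atTop
    (iteratedDeriv 2 (mgf (fun s => -s) m) 1)).and (eventually_ge_atTop 1)).exists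
  have hx0 : 0 < x := one_pos.trans_le hx1
  exact ⟨x, hx0, sub_nonneg.2
    ((antitoneOn_iteratedDeriv_two_mgf_neg hm (mem_Ioi.2 one_pos) hx0 hx1).trans hx)⟩

theorem convexity_of_eqOn_expSubLaplace (hA : 0 < A) (hΦ : 0 < Φ) {W : ℝ → ℝ}
    (hW : EqOn W (fun x => A * Real.exp (Φ * x) - mgf (fun s => -s) m x) (Ioi 0)) :
    (∀ x, 0 < x → DifferentiableAt ℝ W x) ∧
      StrictConvexOn ℝ (Ioi 0) (deriv W) ∧
      ∃ a : ℝ, 0 ≤ a ∧ StrictConcaveOn ℝ (Ioo 0 a) W ∧ StrictConvexOn ℝ (Ioi a) W := by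
  have hW_eq : EqOn W (expSubLaplaceDeriv A Φ m 0) (Ioi 0) := fun x hx => by
    rw [hW hx, expSubLaplaceDeriv, pow_zero, mul_one, iteratedDeriv_zero]
  have hderiv : ∀ {f : ℝ → ℝ} {n : ℕ}, EqOn f (expSubLaplaceDeriv A Φ m n) (Ioi 0) →
      ∀ x, 0 < x → HasDerivAt f (expSubLaplaceDeriv A Φ m (n + 1) x) x := fun hf x hx =>
    (hasDerivAt_expSubLaplaceDeriv hm _ hx).congr_of_eventuallyEq
      (hf.eventuallyEq_of_mem (Ioi_mem_nhds hx))
  have hW' : EqOn (deriv W) (expSubLaplaceDeriv A Φ m 1) (Ioi 0) :=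
    fun x hx => (hderiv hW_eq x hx).deriv
  have hW'' : EqOn (deriv^[2] W) (expSubLaplaceDeriv A Φ m 2) (Ioi 0) :=
    fun x hx => (hderiv hW' x hx).deriv
  have hmono : StrictMonoOn (deriv^[2] W) (Ioi 0) :=
    (strictMonoOn_expSubLaplaceDeriv_two hm hA hΦ).congr hW''.symm
  refine ⟨fun x hx => (hderiv hW_eq x hx).differentiableAt, ?_, ?_⟩
  · refine StrictMonoOn.strictConvexOn_of_deriv (convex_Ioi 0)
      (fun x hx => (hderiv hW' x hx).continuousAt.continuousWithinAt) ?_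
    rwa [interior_Ioi]
  · obtain ⟨x, hx, hx_nonneg⟩ := exists_expSubLaplaceDeriv_two_nonneg hm hA hΦ
    exact exists_strictConcaveOn_strictConvexOn
      (fun x hx => (hderiv hW_eq x hx).continuousAt.continuousWithinAt) hmono
      ⟨x, hx, (hW'' hx).symm ▸ hx_nonneg⟩

end ExpSubLaplace

theorem mainTheorem9_general {μ σ : ℝ} {ν : Measure ℝ} (hν : IsLevyMeasure ν) (h0 : ν (Ioi 0) = 0)
    (hcm : HasCompletelyMonotoneTailDensity ν) {ψ : ℝ → ℝ}
    (hψ : ∀ b, 0 < b → ψ b = levyLaplaceExponent μ σ ν b) {q : ℝ}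
    (hq : 0 < q ∨ (q = 0 ∧ 0 < largestRoot ψ 0)) (hlt : ∃ b, 0 < b ∧ q < ψ b)
    {W : ℝ → ℝ} (hW : IsScaleFunction ψ q W) :
    (∀ x, 0 < x → DifferentiableAt ℝ W x) ∧
      StrictConvexOn ℝ (Ioi 0) (deriv W) ∧
      ∃ a : ℝ, 0 ≤ a ∧ StrictConcaveOn ℝ (Ioo 0 a) W ∧ StrictConvexOn ℝ (Ioi a) W := by
  obtain ⟨R, hR, hR_eq⟩ := hν.exists_levyLaplaceExponent_eq h0 hcm μ σ
  have hψR : ∀ b, 0 < b → ψ b = b * (levyLaplaceExponent μ σ ν 1 + (b - 1) * R b) :=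
    fun b hb => (hψ b hb).trans (hR_eq b hb)
  have hq0 : 0 ≤ q := hq.elim le_of_lt fun h => h.1.ge
  have hne : ∃ b, 0 < b ∧ ψ b ≠ q := hlt.imp fun b hb => ⟨hb.1, hb.2.ne'⟩
  obtain ⟨Φ, hΦ, hΦq⟩ : ∃ Φ, 0 < Φ ∧ ψ Φ = q := by
    rcases hq with hq | ⟨rfl, hroot⟩
    · obtain ⟨b, hb, hqb⟩ := hlt
      exact exists_pos_root hR hψR hq hb hqb
    · exact exists_pos_root_of_largestRoot_pos hroot
  obtain ⟨A, hA, m, hm, hm0, hm_eq⟩ := exists_inv_sub_eq hR hψR hq0 hΦ hΦq hne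
  obtain rfl : largestRoot ψ q = Φ := largestRoot_eq hR hψR hq0 hΦ hΦq hne
  exact convexity_of_eqOn_expSubLaplace hm0 hA hΦ (hW.eqOn_Ioi hA.le hm0 hm_eq)

theorem mainTheorem9 {Ω : Type*} [MeasurableSpace Ω] (P : Measure Ω) [IsProbabilityMeasure P]
    (X : ℝ≥0 → Ω → ℝ) (μ σ : ℝ) (ν : Measure ℝ)
    (hX : IsSpectrallyNegativeLevy X P μ σ ν)
    (hν : HasCompletelyMonotoneTailDensity ν)
    (q : ℝ) (hq : 0 < q ∨ (q = 0 ∧ 0 < largestRoot (laplaceExponent X P) 0))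
    (W : ℝ → ℝ) (hW : IsScaleFunction (laplaceExponent X P) q W) :
    (∀ x, 0 < x → DifferentiableAt ℝ W x) ∧
      StrictConvexOn ℝ (Ioi 0) (deriv W) ∧
      ∃ a : ℝ, 0 ≤ a ∧ StrictConcaveOn ℝ (Ioo 0 a) W ∧ StrictConvexOn ℝ (Ioi a) W := by
  obtain ⟨b, hb, hqb⟩ := hX.exists_lt_levyLaplaceExponent q
  rw [← hX.laplaceExponent_eq hb.le] at hqb
  exact mainTheorem9_general hX.triplet.isLevyMeasure hX.no_pos_jumps hν
    (fun l hl => hX.laplaceExponent_eq hl.le) hq ⟨b, hb, hqb⟩ hW
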